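/- Conventions. Fix a universe of sets: either all sets, or (the small version) the sets belonging to a Grothendieck universe containing $[0,1]$; all spaces and sets below are taken from it. For $\alpha,\beta\colon X\to[0,1]$ write $\alpha\sqsubseteq\beta$ if for every $\varepsilon>0$ there is $\delta>0$ such that for all $x\in X$, $\alpha(x)\le\delta$ implies $\beta(x)\le\varepsilon$; write $\simeq$ for isomorphism in a preorder. $\mathbf{cMet}_1$ is the category of complete metric spaces of diameter at most $1$ and uniformly continuous maps. $\mathbf{CMT}$ is the indexed preorder on $\mathbf{cMet}_1$ whose predicates on $(X,d)$ are the uniformly continuous functions $X\to[0,1]$, preordered by $\sqsubseteq$, with reindexing by precomposition. $\mathbf{U}$ is the hyperdoctrine on sets with $\mathbf{U}(X)=([0,1]^X,\sqsubseteq)$, in which $0$ is truth, $\wedge$ is $\max$ and $\exists$ is the infimum in $[0,1]$. $\mathrm{PER}(\mathbf{U})$ has as objects pairs $(X,\sim)$ with $\sim\,\in\mathbf{U}(X\times X)$ symmetric and transitive in $\mathbf{U}$, and as morphisms $(X,\sim)\to(Y,\sim)$ the $\simeq$-classes of functional relations $F\in\mathbf{U}(X\times Y)$, i.e. those that are strict,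 relational, single-valued and total in $\mathbf{U}$; $[G]\circ[F]$ is the class of $\exists y\,(F(x,y)\wedge G(y,z))$. The functor $G\colon\mathbf{cMet}_1\to\mathrm{PER}(\mathbf{U})$ sends $(X,d)$ to $(X,d)$ and $f$ to the class of $d(f(x),y)$. A strict relation on $(X,\sim)$ is a $\phi\in\mathbf{U}(X)$ with $\phi(x)\vdash x\sim x$ and $\phi(x)\wedge x\sim x'\vdash\phi(x')$. A coherent hyperdoctrine is an indexed preorder on a category with finite products whose fibres are bounded distributive prelattices, preserved by reindexing, with left adjoints $\exists_\pi$ along product projections satisfying the Beck–Chevalley and Frobenius conditions, and with equality predicates ($\top\le\delta^*A\iff \mathrm{Eq}_X\le A$ for all predicates $A$ on $X\times X$) that are componentwise on products. It is universally coherent if it also has right adjoints $\forall_\pi$ along projections satisfying Beck–Chevalley. Proposition. (1) $\mathbf{CMT}$ is a universally coherent hyperdoctrine, the subobject doctrine $\mathrm{Sub}$ of $\mathrm{PER}(\mathbf{U})$ is a coherent hyperdoctrine, and $\mathrm{Sub}\circ G^{op}$ is a universally coherent hyperdoctrine on $\mathbf{cMet}_1$; in particular $G(\pi)^*$ has a right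 adjoint $\forall_{G\pi}$ for each projection $\pi$ of $\mathbf{cMet}_1$. (2) For every object $(X,\sim)$ of $\mathrm{PER}(\mathbf{U})$, sending a strict relation $\phi$ to the subobject represented by the monomorphism $[\phi(x)\wedge x\sim x']\colon(X,\phi(x)\wedge x\sim x')\to(X,\sim)$ preserves and reflects the order and is surjective onto $\mathrm{Sub}(X,\sim)$; pulling this subobject back along $[F]\colon (Z,\sim)\to (X,\sim)$ corresponds to the strict relation $\exists x\,(F(z,x)\wedge\phi(x))$. (3) Every $\phi\in\mathbf{CMT}(X,d)$ is a strict relation on $G(X,d)$. Let $\eta_X(\phi)\in\mathrm{Sub}(G(X,d))$ be the corresponding subobject. Then $(G,\eta)$ is an embedding of hyperdoctrines $\mathbf{CMT}\to(\mathrm{PER}(\mathbf{U}),\mathrm{Sub})$ which preserves all universally coherent structure: $G$ is full and faithful and preserves finite products; $\eta_X(\phi)\le\eta_X(\psi)$ iff $\phi\sqsubseteq\psi$; $\eta$ is natural and preserves $\top,\bot,\wedge,\vee$; for every projection $\pi\colon Y\to X$ in $\mathbf{cMet}_1$, $\eta_X\circ\exists_\pi\simeq\exists_{G\pi}\circ\eta_Y$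 and $\eta_X\circ\forall_\pi\simeq\forall_{G\pi}\circ\eta_Y$; and $\eta_{X\times X}(\mathrm{Eq}_X)\simeq\langle G\pi_1,G\pi_2\rangle^*(\mathrm{Eq}_{GX})$. -/

import Mathlib

open CategoryTheory CategoryTheory.Limits unitInterval

universe u v w u' v' w'

namespace ContLogic

/-! ### Distributive prelattices -/

/-- A preorder whose poset reflection is a (bounded) distributive lattice. Joins and meets in a
preorder are determined up to isomorphism, so they are described by their universal property. -/
structure IsDistPrelattice (A : Type w) [Preorder A] : Prop where
  exists_top : ∃ t : A, IsTop t
  exists_bot : ∃ b : A, IsBot b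
  exists_meet : ∀ a b : A, ∃ m, IsGLB {a, b} m
  exists_join : ∀ a b : A, ∃ j, IsLUB {a, b} j
  distrib : ∀ a b c j m p q : A, IsLUB {b, c} j → IsGLB {a, j} m →
    IsGLB {a, b} p → IsGLB {a, c} q → IsLUB {p, q} m

/-- A monotone map inducing a homomorphism of bounded lattices on poset reflections. -/
structure IsDistPrelatticeHom {A : Type w} {B : Type w'} [Preorder A] [Preorder B]
    (f : A → B) : Prop where
  monotone : Monotone f
  map_top : ∀ t, IsTop t → IsTop (f t)
  map_bot : ∀ b, IsBot b → IsBot (f b)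
  map_meet : ∀ a b m, IsGLB {a, b} m → IsGLB {f a, f b} (f m)
  map_join : ∀ a b j, IsLUB {a, b} j → IsLUB {f a, f b} (f j)

/-- Isomorphism `a ≃ b` of elements of a preorder. -/
abbrev PIso {A : Type w} [Preorder A] (a b : A) : Prop := a ≤ b ∧ b ≤ a

/-! ### Hyperdoctrines -/

/-- A morphism `π : P ⟶ X` which is a projection of a binary product `P = X × Y`. -/
def IsProjection {C : Type u} [Category.{v} C] {P X : C} (π : P ⟶ X) : Prop :=
  ∃ (Y : C) (q : P ⟶ Y), Nonempty (IsLimit (BinaryFan.mk π q))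

/-- An indexed preorder on `C`: a pseudofunctor from `Cᵒᵖ` to preorders. -/
structure IndexedPreorder (C : Type u) [Category.{v} C] where
  /-- The predicates on an object. -/
  pred : C → Type w
  [preorder : ∀ X, Preorder (pred X)]
  /-- Reindexing `f^*` of predicates. -/
  map : ∀ {X Y : C}, (X ⟶ Y) → pred Y → pred X
  map_mono : ∀ {X Y : C} (f : X ⟶ Y), Monotone (map f)
  map_id : ∀ {X : C} (a : pred X), PIso (map (𝟙 X) a) a
  map_comp : ∀ {X Y Z : C} (f : X ⟶ Y) (g : Y ⟶ Z) (a : pred Z),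
    PIso (map (f ≫ g) a) (map f (map g a))

attribute [instance] IndexedPreorder.preorder

namespace IndexedPreorder

variable {C : Type u} [Category.{v} C] {D : Type u'} [Category.{v'} D]

/-- Change of base: the indexed preorder `Q ∘ Fᵒᵖ`. -/
def baseChange (Q : IndexedPreorder.{u', v', w} D) (F : C ⥤ D) :
    IndexedPreorder.{u, v, w} C where
  pred X := Q.pred (F.obj X)
  preorder X := Q.preorder (F.obj X)
  map f := Q.map (F.map f)
  map_mono f := Q.map_mono (F.map f)
  map_id a := by
    rw [F.map_id]
    exact Q.map_id a
  map_comp f g a := by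
    rw [F.map_comp]
    exact Q.map_comp _ _ a

/-- `e` is an equality predicate on `X`: for all predicates `A` on `X × X`,
`⊤ ≤ δ^* A` if and only if `e ≤ A`. -/
def IsEq [HasFiniteProducts C] (P : IndexedPreorder.{u, v, w} C) (X : C)
    (e : P.pred (X ⨯ X)) : Prop :=
  ∀ A : P.pred (X ⨯ X), IsTop (P.map (diag X) A) ↔ e ≤ A

/-- Coherent hyperdoctrines. -/
structure IsCoherent [HasFiniteProducts C] (P : IndexedPreorder.{u, v, w} C) : Prop where
  /-- The fibres are distributive prelattices. -/
  distPrelattice : ∀ X, IsDistPrelattice (P.pred X)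
  /-- Reindexing preserves the lattice structure. -/
  map_hom : ∀ {X Y : C} (f : X ⟶ Y), IsDistPrelatticeHom (P.map f)
  /-- There are left adjoints along projections. -/
  exists_leftAdjoint : ∀ {Y X : C} (π : Y ⟶ X), IsProjection π →
    ∃ l : P.pred Y → P.pred X, GaloisConnection l (P.map π)
  /-- The left adjoints satisfy the Beck-Chevalley condition. -/
  beckChevalley_left : ∀ {A B K L : C} {π : A ⟶ B} {f : A ⟶ K} {g : B ⟶ L} {π' : K ⟶ L},
    IsPullback π f g π' → IsProjection π → IsProjection π' →
    ∀ (l : P.pred A → P.pred B) (l' : P.pred K → P.pred L),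
      GaloisConnection l (P.map π) → GaloisConnection l' (P.map π') →
      ∀ a, PIso (l (P.map f a)) (P.map g (l' a))
  /-- The Frobenius condition `∃_π (π^* α ∧ β) ≃ α ∧ ∃_π β`. -/
  frobenius : ∀ {B A : C} (π : B ⟶ A), IsProjection π →
    ∀ l : P.pred B → P.pred A, GaloisConnection l (P.map π) →
    ∀ (α : P.pred A) (β m : P.pred B) (n : P.pred A),
      IsGLB {P.map π α, β} m → IsGLB {α, l β} n → PIso (l m) n
  /-- There are equality predicates. -/
  exists_eq : ∀ X, ∃ e, P.IsEq X e
  /-- Equality on a product is componentwise equality. -/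
  eq_prod : ∀ (A B : C) (a : P.pred (A ⨯ A)) (b : P.pred (B ⨯ B))
    (c : P.pred ((A ⨯ B) ⨯ (A ⨯ B))), P.IsEq A a → P.IsEq B b → P.IsEq (A ⨯ B) c →
    IsGLB {P.map (prod.map prod.fst prod.fst) a, P.map (prod.map prod.snd prod.snd) b} c

/-- Universally coherent hyperdoctrines. -/
structure IsUniversallyCoherent [HasFiniteProducts C] (P : IndexedPreorder.{u, v, w} C) : Prop
    extends P.IsCoherent where
  /-- There are right adjoints along projections. -/
  exists_rightAdjoint : ∀ {Y X : C} (π : Y ⟶ X), IsProjection π →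
    ∃ r : P.pred Y → P.pred X, GaloisConnection (P.map π) r
  /-- The right adjoints satisfy the Beck-Chevalley condition. -/
  beckChevalley_right : ∀ {A B K L : C} {π : A ⟶ B} {f : A ⟶ K} {g : B ⟶ L} {π' : K ⟶ L},
    IsPullback π f g π' → IsProjection π → IsProjection π' →
    ∀ (r : P.pred A → P.pred B) (r' : P.pred K → P.pred L),
      GaloisConnection (P.map π) r → GaloisConnection (P.map π') r' →
      ∀ a, PIso (r (P.map f a)) (P.map g (r' a))

/-- `(F, η)` is a morphism of coherent hyperdoctrines `P → Q`: `F` preserves finite products, `η`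
is a pseudonatural transformation `P → Q ∘ Fᵒᵖ` of indexed distributive prelattices, and it
commutes with left adjoints along projections and with the equality predicates. -/
structure IsCoherentMorphism [HasFiniteProducts C] [HasFiniteProducts D]
    (P : IndexedPreorder.{u, v, w} C) (Q : IndexedPreorder.{u', v', w'} D)
    (F : C ⥤ D) (η : ∀ X, P.pred X → Q.pred (F.obj X)) : Prop where
  preservesFiniteProducts : PreservesFiniteProducts F
  hom : ∀ X, IsDistPrelatticeHom (η X)
  natural : ∀ {X Y : C} (f : X ⟶ Y) (a : P.pred Y),
    PIso (η X (P.map f a)) (Q.map (F.map f) (η Y a))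
  map_exists : ∀ {Y X : C} (π : Y ⟶ X), IsProjection π →
    ∀ (l : P.pred Y → P.pred X) (l' : Q.pred (F.obj Y) → Q.pred (F.obj X)),
      GaloisConnection l (P.map π) → GaloisConnection l' (Q.map (F.map π)) →
      ∀ a, PIso (η X (l a)) (l' (η Y a))
  map_eq : ∀ (X : C) (e : P.pred (X ⨯ X)) (e' : Q.pred (F.obj X ⨯ F.obj X)),
    P.IsEq X e → Q.IsEq (F.obj X) e' → PIso (η (X ⨯ X) e) (Q.map (prodComparison F X X) e')

/-- A morphism of coherent hyperdoctrines that also commutes with right adjoints along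
projections. -/
structure IsUniversallyCoherentMorphism [HasFiniteProducts C] [HasFiniteProducts D]
    (P : IndexedPreorder.{u, v, w} C) (Q : IndexedPreorder.{u', v', w'} D)
    (F : C ⥤ D) (η : ∀ X, P.pred X → Q.pred (F.obj X)) : Prop
    extends IsCoherentMorphism P Q F η where
  map_forall : ∀ {Y X : C} (π : Y ⟶ X), IsProjection π →
    ∀ (r : P.pred Y → P.pred X) (r' : Q.pred (F.obj Y) → Q.pred (F.obj X)),
      GaloisConnection (P.map π) r → GaloisConnection (Q.map (F.map π)) r' →
      ∀ a, PIso (η X (r a)) (r' (η Y a))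

/-- Fullness of a morphism of hyperdoctrines: the functor is full and faithful, and the
components of `η` preserve and reflect the order. -/
structure IsEmbedding (P : IndexedPreorder.{u, v, w} C) (Q : IndexedPreorder.{u', v', w'} D)
    (F : C ⥤ D) (η : ∀ X, P.pred X → Q.pred (F.obj X)) : Prop where
  full : F.Full
  faithful : F.Faithful
  le_iff : ∀ (X : C) (A B : P.pred X), η X A ≤ η X B ↔ A ≤ B

end IndexedPreorder

/-- The subobject hyperdoctrine of a category with pullbacks. -/
noncomputable def subobjectDoctrine (C : Type u) [Category.{v} C] [HasPullbacks C] :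
    IndexedPreorder.{u, v, max u v} C where
  pred X := Subobject X
  map f := (Subobject.pullback f).obj
  map_mono f := (Subobject.pullback f).monotone
  map_id a := by
    rw [Subobject.pullback_id]
    exact ⟨le_rfl, le_rfl⟩
  map_comp f g a := by
    rw [Subobject.pullback_comp]
    exact ⟨le_rfl, le_rfl⟩

/-! ### Complete metric spaces of diameter at most one -/

/-- Complete metric spaces of diameter at most `1`. -/
structure CMet1 : Type (u + 1) where
  /-- The underlying set. -/
  carrier : Type u
  [metric : MetricSpace carrier]
  [complete : CompleteSpace carrier]
  dist_le_one : ∀ x y : carrier, dist x y ≤ 1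

namespace CMet1

instance : CoeSort CMet1.{u} (Type u) := ⟨carrier⟩

attribute [instance] metric complete

/-- Morphisms are uniformly continuous maps. -/
instance : Category.{u} CMet1.{u} where
  Hom X Y := {f : X → Y // UniformContinuous f}
  id X := ⟨id, uniformContinuous_id⟩
  comp f g := ⟨g.1 ∘ f.1, g.2.comp f.2⟩

theorem hom_ext {X Y : CMet1.{u}} {f g : X ⟶ Y} (h : ∀ x, f.1 x = g.1 x) : f = g :=
  Subtype.ext (funext h)

@[simp] theorem comp_val {X Y Z : CMet1.{u}} (f : X ⟶ Y) (g : Y ⟶ Z) (x : X) :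
    (f ≫ g).1 x = g.1 (f.1 x) := rfl

@[simp] theorem id_val {X : CMet1.{u}} (x : X) : (𝟙 X : X ⟶ X).1 x = x := rfl

/-- The one-point space. -/
def one : CMet1.{u} where
  carrier := PUnit
  dist_le_one _ _ := by simp

/-- The product of two spaces, with the maximum metric. -/
def prodObj (X Y : CMet1.{u}) : CMet1.{u} where
  carrier := X × Y
  dist_le_one _ _ := max_le (X.dist_le_one _ _) (Y.dist_le_one _ _)

instance : HasFiniteProducts CMet1.{u} := by
  have : HasTerminal CMet1.{u} :=
    (IsTerminal.ofUniqueHom (Y := one.{u})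
      (fun X => (⟨fun _ => PUnit.unit, uniformContinuous_const⟩ : {f : X → one.{u} // UniformContinuous f}))
      (fun _ _ => hom_ext fun _ => rfl)).hasTerminal
  have (X Y : CMet1.{u}) : HasLimit (pair X Y) := by
    let p : prodObj X Y ⟶ X := ⟨Prod.fst, uniformContinuous_fst⟩
    let q : prodObj X Y ⟶ Y := ⟨Prod.snd, uniformContinuous_snd⟩
    exact ⟨⟨BinaryFan.mk p q, BinaryFan.IsLimit.mk _
      (fun f g => ⟨fun t => (f.1 t, g.1 t), f.2.prodMk g.2⟩)
      (fun f g => rfl) (fun f g => rfl)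
      (fun f g m h₁ h₂ => hom_ext fun t => by
        subst h₁ h₂
        rfl)⟩⟩
  have : HasBinaryProducts CMet1.{u} := hasBinaryProducts_of_hasLimit_pair _
  exact hasFiniteProducts_of_has_binary_and_terminal

end CMet1

/-! ### Predicates with values in the unit interval -/

/-- The predicates on a set `X` in the hyperdoctrine `U`: all functions `X → [0,1]`. The truth
value `0` is "true"; conjunction is the pointwise maximum, disjunction the pointwise minimum,
existential quantification the infimum in `[0,1]` (so that the empty infimum is `1`). -/
def UPred (X : Type u) : Type u := X → I

/-- The order `α ⊑ β` on the predicates. -/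
def Entails {X : Type u} (α β : UPred X) : Prop :=
  ∀ ε : ℝ, 0 < ε → ∃ δ : ℝ, 0 < δ ∧ ∀ x, (α x : ℝ) ≤ δ → (β x : ℝ) ≤ ε

instance (X : Type u) : Preorder (UPred X) where
  le := Entails
  le_refl _ ε hε := ⟨ε, hε, fun _ h => h⟩
  le_trans _ _ _ h₁ h₂ ε hε := by
    obtain ⟨δ, hδ, h⟩ := h₂ ε hε
    obtain ⟨δ', hδ', h'⟩ := h₁ δ hδ
    exact ⟨δ', hδ', fun x hx => h x (h' x hx)⟩

/-- The hyperdoctrine `U` on the category of sets; reindexing is precomposition. -/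
def U : IndexedPreorder.{u + 1, u, u} (Type u) where
  pred X := UPred X
  map f α := fun x => α (f x)
  map_mono f _ _ h ε hε := by
    obtain ⟨δ, hδ, h'⟩ := h ε hε
    exact ⟨δ, hδ, fun x => h' (f x)⟩
  map_id _ := ⟨le_rfl, le_rfl⟩
  map_comp _ _ _ := ⟨le_rfl, le_rfl⟩

/-- The hyperdoctrine `CMT`: predicates are uniformly continuous functions to `[0,1]`, ordered by
`⊑`, and reindexing is precomposition. -/
def CMT : IndexedPreorder.{u + 1, u, u} CMet1.{u} where
  pred X := {φ : UPred X.carrier // UniformContinuous (fun x => φ x)}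
  map f φ := ⟨fun x => φ.1 (f.1 x), φ.2.comp f.2⟩
  map_mono f _ _ h ε hε := by
    obtain ⟨δ, hδ, h'⟩ := h ε hε
    exact ⟨δ, hδ, fun x => h' (f.1 x)⟩
  map_id _ := ⟨le_rfl, le_rfl⟩
  map_comp _ _ _ := ⟨le_rfl, le_rfl⟩

/-! Entailment can be tested on sequences; this is used to verify the constructions below. -/

/-- The sequence `s` in `[0,1]` converges to `0`. -/
def Null (s : ℕ → I) : Prop := ∀ ε : ℝ, 0 < ε → ∃ N, ∀ n ≥ N, (s n : ℝ) ≤ ε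

theorem entails_iff {X : Type u} (α β : UPred X) :
    Entails α β ↔ ∀ x : ℕ → X, Null (fun n => α (x n)) → Null (fun n => β (x n)) := by
  constructor
  · intro h x hx ε hε
    obtain ⟨δ, hδ, h'⟩ := h ε hε
    obtain ⟨N, hN⟩ := hx δ hδ
    exact ⟨N, fun n hn => h' _ (hN n hn)⟩
  · intro h
    by_contra hc
    unfold Entails at hc
    push Not at hc
    obtain ⟨ε, hε, hc⟩ := hc
    choose x hx hx' using fun n : ℕ => hc (1 / (n + 1)) (by positivity)
    obtain ⟨N, hN⟩ := h x (fun ε' hε' => by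
      obtain ⟨N, hN⟩ := exists_nat_one_div_lt hε'
      refine ⟨N, fun n hn => (hx n).trans (le_trans ?_ hN.le)⟩
      exact Nat.one_div_le_one_div hn) ε hε
    exact absurd (hN N le_rfl) (not_le.2 (hx' N))

theorem null_sup (s t : ℕ → I) : Null (fun n => s n ⊔ t n) ↔ Null s ∧ Null t := by
  constructor
  · intro h
    refine ⟨fun ε hε => ?_, fun ε hε => ?_⟩ <;> obtain ⟨N, hN⟩ := h ε hε <;>
      refine ⟨N, fun n hn => le_trans ?_ (hN n hn)⟩
    · exact Subtype.coe_le_coe.2 le_sup_left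
    · exact Subtype.coe_le_coe.2 le_sup_right
  · rintro ⟨h₁, h₂⟩ ε hε
    obtain ⟨N, hN⟩ := h₁ ε hε
    obtain ⟨M, hM⟩ := h₂ ε hε
    refine ⟨max N M, fun n hn => ?_⟩
    beta_reduce
    rcases le_total (s n) (t n) with h | h
    · rw [sup_of_le_right h]
      exact hM n (le_trans (le_max_right _ _) hn)
    · rw [sup_of_le_left h]
      exact hN n (le_trans (le_max_left _ _) hn)

theorem null_iInf {Y : Type u} (F : ℕ → Y → I) :
    Null (fun n => ⨅ y, F n y) ↔ ∃ y : ℕ → Y, Null (fun n => F n (y n)) := by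
  constructor
  · intro h
    rcases isEmpty_or_nonempty Y with hY | hY
    · obtain ⟨N, hN⟩ := h (1 / 2) (by norm_num)
      have := hN N le_rfl
      beta_reduce at this
      rw [iInf_of_empty] at this
      have h1 : ((⊤ : I) : ℝ) = 1 := rfl
      rw [h1] at this
      norm_num at this
    · have key : ∀ n : ℕ, ∃ y : Y, (F n y : ℝ) ≤ ((⨅ y, F n y : I) : ℝ) + 1 / (n + 1) := by
        intro n
        by_contra hc
        push Not at hc
        set a : I := ⨅ y, F n y with ha
        have hpos : (0 : ℝ) < 1 / (n + 1) := by positivity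
        obtain ⟨y₀⟩ := hY
        have h1 : (a : ℝ) + 1 / (n + 1) ≤ 1 := (hc y₀).le.trans (F n y₀).2.2
        let b : I := ⟨(a : ℝ) + 1 / (n + 1), add_nonneg a.2.1 hpos.le, h1⟩
        have : b ≤ a := le_iInf fun y => Subtype.coe_le_coe.1 (hc y).le
        have h2 : (b : ℝ) ≤ a := this
        have h3 : (b : ℝ) = (a : ℝ) + 1 / (n + 1) := rfl
        linarith
      choose y hy using key
      refine ⟨y, fun ε hε => ?_⟩
      obtain ⟨N, hN⟩ := h (ε / 2) (by positivity)
      obtain ⟨M, hM⟩ := exists_nat_one_div_lt (half_pos hε)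
      refine ⟨max N M, fun n hn => (hy n).trans ?_⟩
      have h1 := hN n (le_trans (le_max_left _ _) hn)
      have h2 : (1 : ℝ) / (n + 1) ≤ 1 / (M + 1) :=
        Nat.one_div_le_one_div (le_trans (le_max_right _ _) hn)
      linarith
  · rintro ⟨y, hy⟩ ε hε
    obtain ⟨N, hN⟩ := hy ε hε
    exact ⟨N, fun n hn => le_trans (Subtype.coe_le_coe.2 (iInf_le _ _)) (hN n hn)⟩

/-- The pointwise maximum is the meet in the fibres of `U`. -/
theorem U_isGLB {X : Type u} (α β : UPred X) :
    IsGLB {α, β} (fun x => α x ⊔ β x : UPred X) := by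
  constructor
  · rintro γ (rfl | rfl)
    · exact (entails_iff _ _).2 fun _ h => ((null_sup _ _).1 h).1
    · exact (entails_iff _ _).2 fun _ h => ((null_sup _ _).1 h).2
  · intro γ h
    exact (entails_iff _ _).2 fun x hx => (null_sup _ _).2
      ⟨(entails_iff _ _).1 (h (Set.mem_insert _ _)) x hx,
        (entails_iff _ _).1 (h (Set.mem_insert_of_mem _ rfl)) x hx⟩

/-- The pointwise infimum is the left adjoint to reindexing along a projection in `U`. -/
theorem U_exists {X Y : Type u} :
    GaloisConnection (α := UPred (X × Y)) (β := UPred X)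
      (fun F x => ⨅ y, F (x, y)) (fun β p => β p.1) := by
  refine fun F α => ⟨fun h => (entails_iff _ _).2 fun p hp => ?_,
    fun h => (entails_iff _ _).2 fun x hx => ?_⟩
  · exact (entails_iff _ _).1 h (fun n => (p n).1) ((null_iInf _).2 ⟨fun n => (p n).2, hp⟩)
  · obtain ⟨y, hy⟩ := (null_iInf _).1 hx
    exact (entails_iff _ _).1 h (fun n => (x n, y n)) hy

/-! ### Partial equivalence relations over `U` -/

/-- Partial equivalence relations over `U`. -/
structure PERU : Type (u + 1) where
  /-- The underlying set. -/
  carrier : Type u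
  /-- The predicate `x ∼ y`. -/
  rel : UPred (carrier × carrier)
  symm : Entails (X := carrier × carrier)
    (fun p => rel (p.1, p.2)) (fun p => rel (p.2, p.1))
  trans : Entails (X := carrier × carrier × carrier)
    (fun p => rel (p.1, p.2.1) ⊔ rel (p.2.1, p.2.2)) (fun p => rel (p.1, p.2.2))

/-- Functional relations between partial equivalence relations. -/
structure FunRel (A B : PERU.{u}) where
  /-- The predicate `F(x, y)`. -/
  rel : UPred (A.carrier × B.carrier)
  strict : Entails (X := A.carrier × B.carrier)
    (fun p => rel (p.1, p.2)) (fun p => A.rel (p.1, p.1) ⊔ B.rel (p.2, p.2))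
  relational : Entails (X := A.carrier × A.carrier × B.carrier × B.carrier)
    (fun p => rel (p.1, p.2.2.1) ⊔ A.rel (p.1, p.2.1) ⊔ B.rel (p.2.2.1, p.2.2.2))
    (fun p => rel (p.2.1, p.2.2.2))
  singleValued : Entails (X := A.carrier × B.carrier × B.carrier)
    (fun p => rel (p.1, p.2.1) ⊔ rel (p.1, p.2.2)) (fun p => B.rel (p.2.1, p.2.2))
  total : Entails (X := A.carrier) (fun x => A.rel (x, x)) (fun x => ⨅ y, rel (x, y))

/-- Strict relations on a partial equivalence relation. -/
structure StrictRel (A : PERU.{u}) where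
  /-- The underlying predicate. -/
  pred : UPred A.carrier
  strict : Entails (X := A.carrier) (fun x => pred x) (fun x => A.rel (x, x))
  relational : Entails (X := A.carrier × A.carrier)
    (fun p => pred p.1 ⊔ A.rel (p.1, p.2)) (fun p => pred p.2)

/-- Strict relations inherit the preorder of the predicates. -/
instance (A : PERU.{u}) : Preorder (StrictRel A) := Preorder.lift StrictRel.pred

namespace PERU

/-- The relation on sequences induced by `∼`. -/
def S (A : PERU.{u}) (a b : ℕ → A.carrier) : Prop := Null fun n => A.rel (a n, b n)

theorem S.symm {A : PERU.{u}} {a b : ℕ → A.carrier} (h : A.S a b) : A.S b a :=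
  (entails_iff _ _).1 A.symm (fun n => (a n, b n)) h

theorem S.trans {A : PERU.{u}} {a b c : ℕ → A.carrier} (h : A.S a b) (h' : A.S b c) : A.S a c :=
  (entails_iff _ _).1 A.trans (fun n => (a n, b n, c n)) ((null_sup _ _).2 ⟨h, h'⟩)

/-- Construct an object from its relation on sequences. -/
def ofSeq (X : Type u) (r : UPred (X × X))
    (hs : ∀ a b : ℕ → X, Null (fun n => r (a n, b n)) → Null (fun n => r (b n, a n)))
    (ht : ∀ a b c : ℕ → X, Null (fun n => r (a n, b n)) → Null (fun n => r (b n, c n)) →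
      Null (fun n => r (a n, c n))) : PERU.{u} where
  carrier := X
  rel := r
  symm := (entails_iff _ _).2 fun x h => hs (fun n => (x n).1) (fun n => (x n).2) h
  trans := (entails_iff _ _).2 fun x h =>
    ht (fun n => (x n).1) (fun n => (x n).2.1) (fun n => (x n).2.2)
      ((null_sup _ _).1 h).1 ((null_sup _ _).1 h).2

end PERU

namespace FunRel

variable {A B K : PERU.{u}}

/-- The relation on sequences induced by a functional relation. -/
def S (F : FunRel A B) (a : ℕ → A.carrier) (b : ℕ → B.carrier) : Prop :=
  Null fun n => F.rel (a n, b n)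

theorem S.left {F : FunRel A B} {a : ℕ → A.carrier} {b : ℕ → B.carrier} (h : F.S a b) :
    A.S a a :=
  ((null_sup _ _).1 ((entails_iff _ _).1 F.strict (fun n => (a n, b n)) h)).1

theorem S.right {F : FunRel A B} {a : ℕ → A.carrier} {b : ℕ → B.carrier} (h : F.S a b) :
    B.S b b :=
  ((null_sup _ _).1 ((entails_iff _ _).1 F.strict (fun n => (a n, b n)) h)).2

theorem S.congr {F : FunRel A B} {a a' : ℕ → A.carrier} {b b' : ℕ → B.carrier} (h : F.S a b)
    (ha : A.S a a') (hb : B.S b b') : F.S a' b' :=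
  (entails_iff _ _).1 F.relational (fun n => (a n, a' n, b n, b' n))
    ((null_sup _ _).2 ⟨(null_sup _ _).2 ⟨h, ha⟩, hb⟩)

theorem S.unique {F : FunRel A B} {a : ℕ → A.carrier} {b b' : ℕ → B.carrier} (h : F.S a b)
    (h' : F.S a b') : B.S b b' :=
  (entails_iff _ _).1 F.singleValued (fun n => (a n, b n, b' n)) ((null_sup _ _).2 ⟨h, h'⟩)

theorem exists_S (F : FunRel A B) {a : ℕ → A.carrier} (h : A.S a a) : ∃ b, F.S a b :=
  (null_iInf _).1 ((entails_iff _ _).1 F.total a h)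

/-- Construct a functional relation from its relation on sequences. -/
def ofSeq (r : UPred (A.carrier × B.carrier)) (s : (ℕ → A.carrier) → (ℕ → B.carrier) → Prop)
    (hr : ∀ a b, Null (fun n => r (a n, b n)) ↔ s a b)
    (h₁ : ∀ a b, s a b → A.S a a ∧ B.S b b)
    (h₂ : ∀ a a' b b', s a b → A.S a a' → B.S b b' → s a' b')
    (h₃ : ∀ a b b', s a b → s a b' → B.S b b')
    (h₄ : ∀ a, A.S a a → ∃ b, s a b) : FunRel A B where
  rel := r
  strict := (entails_iff _ _).2 fun x h =>
    (null_sup _ _).2 (h₁ (fun n => (x n).1) (fun n => (x n).2) ((hr _ _).1 h))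
  relational := (entails_iff _ _).2 fun x h => by
    obtain ⟨h', hb⟩ := (null_sup _ _).1 h
    obtain ⟨hF, ha⟩ := (null_sup _ _).1 h'
    exact (hr (fun n => (x n).2.1) (fun n => (x n).2.2.2)).2
      (h₂ (fun n => (x n).1) _ (fun n => (x n).2.2.1) _ ((hr _ _).1 hF) ha hb)
  singleValued := (entails_iff _ _).2 fun x h =>
    h₃ (fun n => (x n).1) (fun n => (x n).2.1) (fun n => (x n).2.2)
      ((hr _ _).1 ((null_sup _ _).1 h).1) ((hr _ _).1 ((null_sup _ _).1 h).2)
  total := (entails_iff _ _).2 fun a h => by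
    obtain ⟨b, hb⟩ := h₄ a h
    exact (null_iInf _).2 ⟨b, (hr _ _).2 hb⟩

/-- Two functional relations represent the same morphism if they are isomorphic as predicates. -/
instance setoid (A B : PERU.{u}) : Setoid (FunRel A B) where
  r F G := PIso F.rel G.rel
  iseqv := ⟨fun _ => ⟨le_rfl, le_rfl⟩, fun h => ⟨h.2, h.1⟩,
    fun h h' => ⟨h.1.trans h'.1, h'.2.trans h.2⟩⟩

theorem le_iff (F G : FunRel A B) : F.rel ≤ G.rel ↔ ∀ a b, F.S a b → G.S a b := by
  refine (entails_iff _ _).trans ⟨fun h a b => h fun n => (a n, b n), fun h x => ?_⟩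
  exact h (fun n => (x n).1) (fun n => (x n).2)

/-- For equivalence of functional relations a single entailment is enough. -/
theorem equiv_of_le {F G : FunRel A B} (h : F.rel ≤ G.rel) : F ≈ G := by
  refine ⟨h, (le_iff _ _).2 fun a b hab => ?_⟩
  obtain ⟨b', hb'⟩ := F.exists_S hab.left
  exact hb'.congr hab.left (((le_iff _ _).1 h _ _ hb').unique hab)

/-- The identity is represented by `∼` itself. -/
def id (A : PERU.{u}) : FunRel A A :=
  ofSeq A.rel A.S (fun _ _ => Iff.rfl)
    (fun _ _ h => ⟨h.trans h.symm, h.symm.trans h⟩)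
    (fun _ _ _ _ h ha hb => (ha.symm.trans h).trans hb)
    (fun _ _ _ h h' => h.symm.trans h') (fun a h => ⟨a, h⟩)

/-- The composite is represented by `∃ y, F(x, y) ∧ G(y, z)`. -/
noncomputable def comp (F : FunRel A B) (G : FunRel B K) : FunRel A K :=
  ofSeq (fun p => ⨅ y, F.rel (p.1, y) ⊔ G.rel (y, p.2)) (fun a c => ∃ b, F.S a b ∧ G.S b c)
    (fun _ _ => (null_iInf _).trans (exists_congr fun _ => null_sup _ _))
    (fun _ _ ⟨_, h, h'⟩ => ⟨h.left, h'.right⟩)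
    (fun _ _ _ _ ⟨b, h, h'⟩ ha hc => ⟨b, h.congr ha h.right, h'.congr h'.left hc⟩)
    (fun _ _ _ ⟨_, h₁, h₁'⟩ ⟨_, h₂, h₂'⟩ =>
      (h₁'.congr (h₁.unique h₂) h₁'.right).unique h₂')
    (fun _ h => by
      obtain ⟨b, hb⟩ := F.exists_S h
      obtain ⟨c, hc⟩ := G.exists_S hb.right
      exact ⟨c, b, hb, hc⟩)

theorem comp_S (F : FunRel A B) (G : FunRel B K) (a c) :
    (F.comp G).S a c ↔ ∃ b, F.S a b ∧ G.S b c :=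
  (null_iInf _).trans (exists_congr fun _ => null_sup _ _)

end FunRel

/-- The category `PER(U)`: morphisms are equivalence classes of functional relations. -/
noncomputable instance : Category.{u} PERU.{u} where
  Hom A B := Quotient (FunRel.setoid A B)
  id A := ⟦FunRel.id A⟧
  comp := Quotient.map₂ FunRel.comp fun F F' h G G' h' => FunRel.equiv_of_le <|
    (FunRel.le_iff _ _).2 fun a c hac => by
      obtain ⟨b, hF, hG⟩ := (FunRel.comp_S _ _ _ _).1 hac
      exact (FunRel.comp_S _ _ _ _).2
        ⟨b, (FunRel.le_iff _ _).1 h.1 _ _ hF, (FunRel.le_iff _ _).1 h'.1 _ _ hG⟩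
  id_comp := by
    rintro A B ⟨F⟩
    refine Quotient.sound (FunRel.equiv_of_le ((FunRel.le_iff _ _).2 fun a b hab => ?_))
    obtain ⟨a', h, h'⟩ := (FunRel.comp_S _ _ _ _).1 hab
    exact h'.congr (PERU.S.symm h) h'.right
  comp_id := by
    rintro A B ⟨F⟩
    refine Quotient.sound (FunRel.equiv_of_le ((FunRel.le_iff _ _).2 fun a b hab => ?_))
    obtain ⟨b', h, h'⟩ := (FunRel.comp_S _ _ _ _).1 hab
    exact h.congr h.left h'
  assoc := by
    rintro A B K L ⟨F⟩ ⟨G⟩ ⟨H⟩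
    refine Quotient.sound (FunRel.equiv_of_le ((FunRel.le_iff _ _).2 fun a d had => ?_))
    obtain ⟨c, h, h'⟩ := (FunRel.comp_S _ _ _ _).1 had
    obtain ⟨b, h'', h'''⟩ := (FunRel.comp_S _ _ _ _).1 h
    exact (FunRel.comp_S _ _ _ _).2 ⟨b, h'', (FunRel.comp_S _ _ _ _).2 ⟨c, h''', h'⟩⟩

/-- The morphism represented by a functional relation. -/
def FunRel.hom {A B : PERU.{u}} (F : FunRel A B) : A ⟶ B := Quotient.mk (FunRel.setoid A B) F

namespace PERU

theorem exists_hom {A B : PERU.{u}} (f : A ⟶ B) : ∃ F : FunRel A B, f = F.hom := by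
  obtain ⟨F, hF⟩ := Quotient.exists_rep f
  exact ⟨F, hF.symm⟩

theorem hom_eq_iff {A B : PERU.{u}} (F G : FunRel A B) :
    F.hom = G.hom ↔ ∀ a b, F.S a b → G.S a b :=
  ⟨fun h => (FunRel.le_iff _ _).1 (Quotient.exact h).1,
    fun h => Quotient.sound (FunRel.equiv_of_le ((FunRel.le_iff _ _).2 h))⟩

theorem hom_comp {A B K : PERU.{u}} (F : FunRel A B) (G : FunRel B K) :
    F.hom ≫ G.hom = (F.comp G).hom := rfl

/-- The terminal object. -/
def one : PERU.{u} :=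
  ofSeq PUnit (fun _ => 0) (fun _ _ h => h) (fun _ _ _ h _ => h)

theorem one_S (a b : ℕ → one.{u}.carrier) : one.S a b :=
  fun _ hε => ⟨0, fun _ _ => hε.le⟩

/-- The unique morphism to the terminal object. -/
def toOne (A : PERU.{u}) : FunRel A one.{u} :=
  FunRel.ofSeq (fun p => A.rel (p.1, p.1)) (fun a _ => A.S a a) (fun _ _ => Iff.rfl)
    (fun _ _ h => ⟨h, one_S _ _⟩) (fun _ _ _ _ _ h _ => h.symm.trans h)
    (fun _ _ _ _ _ => one_S _ _) (fun _ h => ⟨fun _ => PUnit.unit, h⟩)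

/-- The pullback of two functional relations. -/
noncomputable def pb {A B K : PERU.{u}} (F : FunRel A K) (G : FunRel B K) : PERU.{u} :=
  ofSeq (A.carrier × B.carrier)
    (fun p => (A.rel (p.1.1, p.2.1) ⊔ B.rel (p.1.2, p.2.2)) ⊔
      ⨅ z, F.rel (p.1.1, z) ⊔ G.rel (p.1.2, z))
    (fun a b h => by
      simp only [null_sup, null_iInf] at h ⊢
      obtain ⟨⟨h₁, h₂⟩, z, h₃, h₄⟩ := h
      exact ⟨⟨S.symm h₁, S.symm h₂⟩, z, FunRel.S.congr h₃ h₁ (FunRel.S.right h₃),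
        FunRel.S.congr h₄ h₂ (FunRel.S.right h₄)⟩)
    (fun a b c h h' => by
      simp only [null_sup, null_iInf] at h h' ⊢
      obtain ⟨⟨h₁, h₂⟩, z, h₃, h₄⟩ := h
      exact ⟨⟨S.trans h₁ h'.1.1, S.trans h₂ h'.1.2⟩, z, h₃, h₄⟩)

section pb

variable {A B K : PERU.{u}} (F : FunRel A K) (G : FunRel B K)

theorem pb_S (p q : ℕ → (pb F G).carrier) : (pb F G).S p q ↔
    (A.S (fun n => (p n).1) (fun n => (q n).1) ∧ B.S (fun n => (p n).2) (fun n => (q n).2)) ∧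
      ∃ z, F.S (fun n => (p n).1) z ∧ G.S (fun n => (p n).2) z := by
  refine (null_sup _ _).trans (and_congr (null_sup _ _) ?_)
  exact (null_iInf _).trans (exists_congr fun _ => null_sup _ _)

/-- First projection of the pullback. -/
noncomputable def pbFst : FunRel (pb F G) A :=
  FunRel.ofSeq (fun p => A.rel (p.1.1, p.2) ⊔ (pb F G).rel (p.1, p.1))
    (fun p a => A.S (fun n => (p n).1) a ∧ (pb F G).S p p)
    (fun _ _ => null_sup _ _)
    (fun _ _ h => ⟨h.2, h.1.symm.trans h.1⟩)
    (fun _ _ _ _ h hp ha =>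
      ⟨(((pb_S F G _ _).1 hp).1.1.symm.trans h.1).trans ha, hp.symm.trans hp⟩)
    (fun _ _ _ h h' => h.1.symm.trans h'.1)
    (fun _ h => ⟨_, ((pb_S F G _ _).1 h).1.1, h⟩)

/-- Second projection of the pullback. -/
noncomputable def pbSnd : FunRel (pb F G) B :=
  FunRel.ofSeq (fun p => B.rel (p.1.2, p.2) ⊔ (pb F G).rel (p.1, p.1))
    (fun p b => B.S (fun n => (p n).2) b ∧ (pb F G).S p p)
    (fun _ _ => null_sup _ _)
    (fun _ _ h => ⟨h.2, h.1.symm.trans h.1⟩)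
    (fun _ _ _ _ h hp ha =>
      ⟨(((pb_S F G _ _).1 hp).1.2.symm.trans h.1).trans ha, hp.symm.trans hp⟩)
    (fun _ _ _ h h' => h.1.symm.trans h'.1)
    (fun _ h => ⟨_, ((pb_S F G _ _).1 h).1.2, h⟩)

theorem pbFst_S (p a) : (pbFst F G).S p a ↔ A.S (fun n => (p n).1) a ∧ (pb F G).S p p :=
  null_sup _ _

theorem pbSnd_S (p b) : (pbSnd F G).S p b ↔ B.S (fun n => (p n).2) b ∧ (pb F G).S p p :=
  null_sup _ _

theorem pb_condition : (pbFst F G).hom ≫ F.hom = (pbSnd F G).hom ≫ G.hom := by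
  rw [hom_comp, hom_comp, hom_eq_iff]
  intro p z h
  obtain ⟨a, h₁, h₂⟩ := (FunRel.comp_S _ _ _ _).1 h
  obtain ⟨h₃, hp⟩ := (pbFst_S F G _ _).1 h₁
  obtain ⟨⟨ha, hb⟩, w, h₄, h₅⟩ := (pb_S F G _ _).1 hp
  exact (FunRel.comp_S _ _ _ _).2 ⟨_, (pbSnd_S F G _ _).2 ⟨hb, hp⟩,
    h₅.congr hb ((h₄.congr h₃ h₄.right).unique h₂)⟩

variable {F G}

/-- The mediating functional relation into the pullback. -/
noncomputable def pbLift {T : PERU.{u}} (P : FunRel T A) (Q : FunRel T B)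
    (h : P.hom ≫ F.hom = Q.hom ≫ G.hom) : FunRel T (pb F G) :=
  FunRel.ofSeq (fun p => P.rel (p.1, p.2.1) ⊔ Q.rel (p.1, p.2.2))
    (fun t p => P.S t (fun n => (p n).1) ∧ Q.S t (fun n => (p n).2))
    (fun _ _ => null_sup _ _)
    (fun t p hp => by
      refine ⟨hp.1.left, (pb_S F G _ _).2 ⟨⟨hp.1.right, hp.2.right⟩, ?_⟩⟩
      rw [hom_comp, hom_comp, hom_eq_iff] at h
      obtain ⟨z, hz⟩ := F.exists_S hp.1.right
      obtain ⟨b, hb, hb'⟩ := (FunRel.comp_S _ _ _ _).1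
        (h t z ((FunRel.comp_S _ _ _ _).2 ⟨_, hp.1, hz⟩))
      exact ⟨z, hz, hb'.congr (hb.unique hp.2) hb'.right⟩)
    (fun _ _ _ _ hp ht h' =>
      ⟨hp.1.congr ht ((pb_S F G _ _).1 h').1.1, hp.2.congr ht ((pb_S F G _ _).1 h').1.2⟩)
    (fun t p q hp hq => by
      refine (pb_S F G _ _).2 ⟨⟨hp.1.unique hq.1, hp.2.unique hq.2⟩, ?_⟩
      rw [hom_comp, hom_comp, hom_eq_iff] at h
      obtain ⟨z, hz⟩ := F.exists_S hp.1.right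
      obtain ⟨b, hb, hb'⟩ := (FunRel.comp_S _ _ _ _).1
        (h t z ((FunRel.comp_S _ _ _ _).2 ⟨_, hp.1, hz⟩))
      exact ⟨z, hz, hb'.congr (hb.unique hp.2) hb'.right⟩)
    (fun t ht => by
      obtain ⟨a, ha⟩ := P.exists_S ht
      obtain ⟨b, hb⟩ := Q.exists_S ht
      exact ⟨fun n => (a n, b n), ha, hb⟩)

theorem pbLift_S {T : PERU.{u}} (P : FunRel T A) (Q : FunRel T B)
    (h : P.hom ≫ F.hom = Q.hom ≫ G.hom) (t p) :
    (pbLift P Q h).S t p ↔ P.S t (fun n => (p n).1) ∧ Q.S t (fun n => (p n).2) :=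
  null_sup _ _

theorem isPullback_pb : IsPullback (pbFst F G).hom (pbSnd F G).hom F.hom G.hom := by
  refine ⟨⟨pb_condition F G⟩, ⟨PullbackCone.IsLimit.mk _ (fun s => ?_) ?_ ?_ ?_⟩⟩
  · exact (pbLift (F := F) (G := G) (exists_hom s.fst).choose (exists_hom s.snd).choose (by
      rw [← (exists_hom s.fst).choose_spec, ← (exists_hom s.snd).choose_spec]
      exact s.condition)).hom
  · intro s
    conv_rhs => rw [(exists_hom s.fst).choose_spec]
    rw [hom_comp, hom_eq_iff]
    intro t a hta
    obtain ⟨p, hp, hpa⟩ := (FunRel.comp_S _ _ _ _).1 hta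
    have hp' := (pbLift_S _ _ _ _ _).1 hp
    exact hp'.1.congr hp'.1.left ((pbFst_S _ _ _ _).1 hpa).1
  · intro s
    conv_rhs => rw [(exists_hom s.snd).choose_spec]
    rw [hom_comp, hom_eq_iff]
    intro t a hta
    obtain ⟨p, hp, hpa⟩ := (FunRel.comp_S _ _ _ _).1 hta
    have hp' := (pbLift_S _ _ _ _ _).1 hp
    exact hp'.2.congr hp'.2.left ((pbSnd_S _ _ _ _).1 hpa).1
  · intro s m h₁ h₂
    obtain ⟨M, rfl⟩ := exists_hom m
    rw [(exists_hom s.fst).choose_spec, hom_comp, hom_eq_iff] at h₁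
    rw [(exists_hom s.snd).choose_spec, hom_comp, hom_eq_iff] at h₂
    rw [hom_eq_iff]
    intro t p hp
    refine (pbLift_S _ _ _ _ _).2 ⟨h₁ _ _ ?_, h₂ _ _ ?_⟩
    · exact (FunRel.comp_S _ _ _ _).2
        ⟨p, hp, (pbFst_S _ _ _ _).2 ⟨((pb_S _ _ _ _).1 hp.right).1.1, hp.right⟩⟩
    · exact (FunRel.comp_S _ _ _ _).2
        ⟨p, hp, (pbSnd_S _ _ _ _).2 ⟨((pb_S _ _ _ _).1 hp.right).1.2, hp.right⟩⟩

end pb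

instance : HasFiniteLimits PERU.{u} := by
  have : HasTerminal PERU.{u} :=
    (IsTerminal.ofUniqueHom (Y := one.{u}) (fun A => (toOne A).hom) (fun A m => by
      obtain ⟨M, rfl⟩ := exists_hom m
      rw [hom_eq_iff]
      exact fun _ _ h => h.left)).hasTerminal
  have : ∀ {A B K : PERU.{u}} {f : A ⟶ K} {g : B ⟶ K}, HasLimit (cospan f g) := by
    intro A B K f g
    obtain ⟨F, rfl⟩ := exists_hom f
    obtain ⟨G, rfl⟩ := exists_hom g
    exact isPullback_pb.hasPullback
  have : HasPullbacks PERU.{u} := hasPullbacks_of_hasLimit_cospan _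
  exact hasFiniteLimits_of_hasTerminal_and_pullbacks

end PERU

/-! ### Strict relations as subobjects -/

namespace StrictRel

variable {A B : PERU.{u}}

theorem null_congr (φ : StrictRel A) {a b : ℕ → A.carrier} (h : Null fun n => φ.pred (a n))
    (hab : A.S a b) : Null fun n => φ.pred (b n) :=
  (entails_iff _ _).1 φ.relational (fun n => (a n, b n)) ((null_sup _ _).2 ⟨h, hab⟩)

theorem null_refl (φ : StrictRel A) {a : ℕ → A.carrier} (h : Null fun n => φ.pred (a n)) :
    A.S a a :=
  (entails_iff _ _).1 φ.strict a h

/-- The partial equivalence relation `x ∼_φ x'`, that is, `φ(x) ∧ x ∼ x'`. -/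
def obj (φ : StrictRel A) : PERU.{u} :=
  PERU.ofSeq A.carrier (fun p => φ.pred p.1 ⊔ A.rel (p.1, p.2))
    (fun a b h => by
      obtain ⟨h₁, h₂⟩ := (null_sup _ _).1 h
      exact (null_sup _ _).2 ⟨φ.null_congr h₁ h₂, PERU.S.symm h₂⟩)
    (fun a b c h h' => by
      obtain ⟨h₁, h₂⟩ := (null_sup _ _).1 h
      exact (null_sup _ _).2 ⟨h₁, PERU.S.trans h₂ ((null_sup _ _).1 h').2⟩)

theorem obj_S (φ : StrictRel A) (a b : ℕ → A.carrier) :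
    φ.obj.S a b ↔ (Null fun n => φ.pred (a n)) ∧ A.S a b :=
  null_sup _ _

/-- The functional relation `∼_φ` from `(A, ∼_φ)` to `(A, ∼)`. -/
def incl (φ : StrictRel A) : FunRel φ.obj A :=
  FunRel.ofSeq (A := φ.obj) (fun p => φ.pred p.1 ⊔ A.rel (p.1, p.2)) φ.obj.S
    (fun _ _ => Iff.rfl)
    (fun a b h => ⟨h.trans h.symm, ((obj_S _ _ _).1 (h.symm.trans h)).2⟩)
    (fun a a' b b' h ha hb => by
      obtain ⟨h₁, h₂⟩ := (obj_S _ _ _).1 h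
      exact ha.symm.trans ((obj_S _ _ _).2 ⟨h₁, h₂.trans hb⟩))
    (fun a b b' h h' => ((obj_S _ _ _).1 h).2.symm.trans ((obj_S _ _ _).1 h').2)
    (fun a h => ⟨a, h⟩)

instance (φ : StrictRel A) : Mono φ.incl.hom where
  right_cancellation {T} g h e := by
    obtain ⟨G, rfl⟩ := PERU.exists_hom g
    obtain ⟨H, rfl⟩ := PERU.exists_hom h
    rw [PERU.hom_comp, PERU.hom_comp, PERU.hom_eq_iff] at e
    rw [PERU.hom_eq_iff]
    intro t a ha
    obtain ⟨b, hb, hb'⟩ := (FunRel.comp_S _ _ _ _).1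
      (e t a ((FunRel.comp_S _ _ _ _).2 ⟨a, ha, ha.right⟩))
    exact hb.congr hb.left hb'

/-- The subobject of `A` represented by the monomorphism `[∼_φ]`. -/
noncomputable def toSubobject (φ : StrictRel A) : Subobject A := Subobject.mk φ.incl.hom

/-- The pullback `∃ y, F(x, y) ∧ φ(y)` of a strict relation along a functional relation. -/
noncomputable def pullback (F : FunRel A B) (φ : StrictRel B) : StrictRel A where
  pred x := ⨅ y, F.rel (x, y) ⊔ φ.pred y
  strict := (entails_iff _ _).2 fun a h => by
    simp only [null_sup, null_iInf] at h
    obtain ⟨b, h, -⟩ := h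
    exact FunRel.S.left h
  relational := (entails_iff _ _).2 fun p h => by
    simp only [null_sup, null_iInf] at h ⊢
    obtain ⟨⟨b, h₁, h₂⟩, h₃⟩ := h
    exact ⟨b, FunRel.S.congr h₁ h₃ (FunRel.S.right h₁), h₂⟩

end StrictRel

/-! ### The functor `G` and the map on predicates -/

/-- The distance of a complete metric space of diameter at most one, with values in `[0,1]`. -/
def CMet1.distI (X : CMet1.{u}) (x y : X.carrier) : I := ⟨dist x y, dist_nonneg, X.dist_le_one x y⟩

namespace GFun

/-- The value of `G` on objects: `x ∼ y` is the distance `d(x, y)`. -/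
def obj (X : CMet1.{u}) : PERU.{u} where
  carrier := X.carrier
  rel p := X.distI p.1 p.2
  symm ε hε := ⟨ε, hε, fun p h => (dist_comm p.2 p.1).trans_le h⟩
  trans ε hε := ⟨ε / 2, half_pos hε, fun p h => by
    have h₁ : dist p.1 p.2.1 ≤ ε / 2 :=
      le_trans (Subtype.coe_le_coe.2 (le_sup_left :
        X.distI p.1 p.2.1 ≤ X.distI p.1 p.2.1 ⊔ X.distI p.2.1 p.2.2)) h
    have h₂ : dist p.2.1 p.2.2 ≤ ε / 2 :=
      le_trans (Subtype.coe_le_coe.2 (le_sup_right :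
        X.distI p.2.1 p.2.2 ≤ X.distI p.1 p.2.1 ⊔ X.distI p.2.1 p.2.2)) h
    have h₃ : dist p.1 p.2.2 ≤ ε := by
      linarith [dist_triangle p.1 p.2.1 p.2.2]
    exact h₃⟩

theorem S_refl (X : CMet1.{u}) (a : ℕ → X.carrier) : (obj X).S a a := fun _ hε =>
  ⟨0, fun n _ => (dist_self (a n)).trans_le hε.le⟩

theorem S_map {X Y : CMet1.{u}} (f : X ⟶ Y) {a b : ℕ → X.carrier} (h : (obj X).S a b) :
    (obj Y).S (fun n => f.1 (a n)) (fun n => f.1 (b n)) := fun ε hε => by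
  obtain ⟨δ, hδ, hf⟩ := Metric.uniformContinuous_iff.1 f.2 ε hε
  obtain ⟨N, hN⟩ := h (δ / 2) (half_pos hδ)
  exact ⟨N, fun n hn => (hf (lt_of_le_of_lt (hN n hn) (half_lt_self hδ))).le⟩

/-- The functional relation `d(f(x), y)` representing `G(f)`. -/
def map {X Y : CMet1.{u}} (f : X ⟶ Y) : FunRel (obj X) (obj Y) :=
  FunRel.ofSeq (A := obj X) (B := obj Y) (fun p => Y.distI (f.1 p.1) p.2)
    (fun a b => (obj Y).S (fun n => f.1 (a n)) b) (fun _ _ => Iff.rfl)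
    (fun _ _ _ => ⟨S_refl X _, S_refl Y _⟩)
    (fun _ _ _ _ h ha hb => ((S_map f ha).symm.trans h).trans hb)
    (fun _ _ _ h h' => h.symm.trans h')
    (fun a _ => ⟨fun n => f.1 (a n), S_refl Y _⟩)

/-- The strict relation on `G X` given by a predicate of `CMT`, which has the same underlying
function. -/
def strictRel (X : CMet1.{u}) (φ : CMT.pred X) : StrictRel (obj X) where
  pred := φ.1
  strict _ hε := ⟨1, one_pos, fun x _ => (dist_self (α := X.carrier) x).trans_le hε.le⟩
  relational ε hε := by
    obtain ⟨δ, hδ, h⟩ := Metric.uniformContinuous_iff.1 φ.2 (ε / 2) (half_pos hε)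
    refine ⟨min (ε / 2) (δ / 2), lt_min (half_pos hε) (half_pos hδ), fun p hp => ?_⟩
    have h₁ : (φ.1 p.1 : ℝ) ≤ ε / 2 := (le_trans (Subtype.coe_le_coe.2 (le_sup_left :
        φ.1 p.1 ≤ φ.1 p.1 ⊔ (obj X).rel (p.1, p.2))) hp).trans (min_le_left _ _)
    have h₂ : X.metric.dist p.1 p.2 ≤ δ / 2 := (le_trans (Subtype.coe_le_coe.2 (le_sup_right :
        (obj X).rel (p.1, p.2) ≤ φ.1 p.1 ⊔ (obj X).rel (p.1, p.2))) hp).trans (min_le_right _ _)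
    have h₃ := abs_lt.1 (h (lt_of_le_of_lt h₂ (half_lt_self hδ)))
    have h₄ : (φ.1 p.2 : ℝ) ≤ ε := by linarith [h₃.1]
    exact h₄

end GFun

/-- The functor `G` from complete metric spaces of diameter at most one to `PER(U)`. -/
noncomputable def G : CMet1.{u} ⥤ PERU.{u} where
  obj := GFun.obj
  map f := (GFun.map f).hom
  map_id _ := (PERU.hom_eq_iff _ _).2 fun _ _ h => h
  map_comp f _ := (PERU.hom_eq_iff _ _).2 fun a _ h =>
    (FunRel.comp_S _ _ _ _).2 ⟨fun n => f.1 (a n), GFun.S_refl _ _, h⟩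

/-- The action of the embedding on predicates: a predicate is regarded as a strict relation, and
the latter as a subobject. -/
noncomputable def embPred (X : CMet1.{u}) (φ : CMT.pred X) :
    (subobjectDoctrine PERU.{u}).pred (G.obj X) :=
  (GFun.strictRel X φ).toSubobject

end ContLogic

open ContLogic ContLogic.IndexedPreorder

namespace ContLogic

/-! ### Equivalences of preorders -/

section Preorder

variable {A : Type w} {B : Type w'} [Preorder A] [Preorder B]

/-! The order of `U` can be tested on sequences: α ⊑ β holds iff every sequence along which α tends
to 0 is one along which β tends to 0. Under this translation max becomes "and", and an infimum
becomes "there is a sequence of witnesses". Hence ∼, strict relations and functional relations turn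
into ordinary predicates and relations on sequences, and a morphism of PER(U) is a total relation,
single-valued up to ∼. Minima and suprema do not translate this way, so joins and ∀ are treated by
ε-δ arguments.

Coherence of Sub: strict relations form a coherent doctrine by reasoning on sequences (images give
∃, and equality is the image of ⊤ under the diagonal). This doctrine is equivalent to Sub: a mono is
recovered from its image, because its converse relation is functional on that image
(`toSubobject_surjective`, `pullback_toSubobject`).

Universal coherence of CMT: ∃ and ∀ along a projection are inf and sup over the fibre, which
preserve moduli of uniform continuity, and the metric is the equality predicate.

The link is that a strict relation φ on G(X) is isomorphic to the 1-Lipschitz function x ↦ inf_y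
max(φ(y), d(x,y)) (`exists_strictRel_pIso`). So η is an equivalence of CMT with Sub ∘ Gᵒᵖ, not
merely an embedding. All structure defined by order and reindexing is therefore preserved by η and
transported along it; in particular the ∀ of Sub ∘ Gᵒᵖ comes from CMT. Fullness of G uses
completeness: the approximate values of a functional relation at a point form a Cauchy sequence,
whose limit is the value of the required function. -/

theorem PIso.rfl {a : A} : PIso a a := ⟨le_rfl, le_rfl⟩

theorem PIso.symm {a b : A} (h : PIso a b) : PIso b a := ⟨h.2, h.1⟩

theorem PIso.trans {a b c : A} (h : PIso a b) (h' : PIso b c) : PIso a c :=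
  ⟨h.1.trans h'.1, h'.2.trans h.2⟩

theorem PIso.le_iff {a a' b b' : A} (h : PIso a a') (h' : PIso b b') : a ≤ b ↔ a' ≤ b' :=
  ⟨fun k => h.2.trans (k.trans h'.1), fun k => h.1.trans (k.trans h'.2)⟩

theorem PIso.isTop_iff {a b : A} (h : PIso a b) : IsTop a ↔ IsTop b :=
  ⟨fun k c => (k c).trans h.1, fun k c => (k c).trans h.2⟩

theorem PIso.map {f : A → B} (hf : Monotone f) {a b : A} (h : PIso a b) : PIso (f a) (f b) :=
  ⟨hf h.1, hf h.2⟩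

theorem isGLB_pair_iff {a b m : A} :
    IsGLB {a, b} m ↔ m ≤ a ∧ m ≤ b ∧ ∀ c, c ≤ a → c ≤ b → c ≤ m := by
  simp [IsGLB, IsGreatest, mem_upperBounds, and_assoc]

theorem isLUB_pair_iff {a b m : A} :
    IsLUB {a, b} m ↔ a ≤ m ∧ b ≤ m ∧ ∀ c, a ≤ c → b ≤ c → m ≤ c := by
  simp [IsLUB, IsLeast, mem_lowerBounds, and_assoc]

theorem _root_.IsGLB.of_pIso {a b m m' : A} (h : IsGLB {a, b} m) (k : PIso m m') : IsGLB {a, b} m' := by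
  rw [isGLB_pair_iff] at h ⊢
  exact ⟨k.2.trans h.1, k.2.trans h.2.1, fun c h₁ h₂ => (h.2.2 c h₁ h₂).trans k.1⟩

theorem _root_.IsGLB.congr_pIso {a b a' b' m : A} (h : IsGLB {a, b} m) (ha : PIso a a')
    (hb : PIso b b') : IsGLB {a', b'} m := by
  rw [isGLB_pair_iff] at h ⊢
  exact ⟨h.1.trans ha.1, h.2.1.trans hb.1, fun c h₁ h₂ => h.2.2 c (h₁.trans ha.2) (h₂.trans hb.2)⟩

theorem _root_.IsLUB.of_pIso {a b m m' : A} (h : IsLUB {a, b} m) (k : PIso m m') : IsLUB {a, b} m' := by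
  rw [isLUB_pair_iff] at h ⊢
  exact ⟨h.1.trans k.1, h.2.1.trans k.1, fun c h₁ h₂ => k.2.trans (h.2.2 c h₁ h₂)⟩

theorem _root_.IsLUB.congr_pIso {a b a' b' m : A} (h : IsLUB {a, b} m) (ha : PIso a a')
    (hb : PIso b b') : IsLUB {a', b'} m := by
  rw [isLUB_pair_iff] at h ⊢
  exact ⟨ha.2.trans h.1, hb.2.trans h.2.1, fun c h₁ h₂ => h.2.2 c (ha.1.trans h₁) (hb.1.trans h₂)⟩

/-- A distributive prelattice from a choice of finite meets and joins. -/
theorem IsDistPrelattice.of_ops {t b : A} {inf sup : A → A → A} (ht : IsTop t) (hb : IsBot b)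
    (hinf : ∀ x y, IsGLB {x, y} (inf x y)) (hsup : ∀ x y, IsLUB {x, y} (sup x y))
    (hd : ∀ x y z, inf x (sup y z) ≤ sup (inf x y) (inf x z)) : IsDistPrelattice A where
  exists_top := ⟨t, ht⟩
  exists_bot := ⟨b, hb⟩
  exists_meet x y := ⟨_, hinf x y⟩
  exists_join x y := ⟨_, hsup x y⟩
  distrib x y z j m p q hj hm hp hq := by
    simp only [isGLB_pair_iff, isLUB_pair_iff] at *
    refine ⟨hm.2.2 _ hp.1 (hp.2.1.trans hj.1), hm.2.2 _ hq.1 (hq.2.1.trans hj.2.1),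
      fun c h₁ h₂ => ?_⟩
    refine ((hinf x (sup y z)).2.2 m hm.1 (hm.2.1.trans (hj.2.2 _ (hsup y z).1
      (hsup y z).2.1))).trans ((hd x y z).trans ((hsup _ _).2.2 _ ?_ ?_))
    · exact (hp.2.2 _ (hinf x y).1 (hinf x y).2.1).trans h₁
    · exact (hq.2.2 _ (hinf x z).1 (hinf x z).2.1).trans h₂

/-- A homomorphism of distributive prelattices may be tested on a choice of meets and joins. -/
theorem IsDistPrelatticeHom.of_ops {t b : A} {inf sup : A → A → A} {f : A → B}
    (hf : Monotone f) (ht : IsTop (f t)) (hb : IsBot (f b))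
    (hinf : ∀ x y, IsGLB {x, y} (inf x y)) (hsup : ∀ x y, IsLUB {x, y} (sup x y))
    (hinf' : ∀ x y c, c ≤ f x → c ≤ f y → c ≤ f (inf x y))
    (hsup' : ∀ x y c, f x ≤ c → f y ≤ c → f (sup x y) ≤ c) : IsDistPrelatticeHom f where
  monotone := hf
  map_top s hs c := (ht c).trans (hf (hs t))
  map_bot s hs c := (hf (hs b)).trans (hb c)
  map_meet x y m hm := by
    simp only [isGLB_pair_iff] at *
    exact ⟨hf hm.1, hf hm.2.1, fun c h₁ h₂ =>
      (hinf' x y c h₁ h₂).trans (hf (hm.2.2 _ (hinf x y).1 (hinf x y).2.1))⟩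
  map_join x y m hm := by
    simp only [isLUB_pair_iff] at *
    exact ⟨hf hm.1, hf hm.2.1, fun c h₁ h₂ =>
      (hf (hm.2.2 _ (hsup x y).1 (hsup x y).2.1)).trans (hsup' x y c h₁ h₂)⟩

/-- An equivalence of preorders: a map that preserves and reflects the order and is surjective up
to isomorphism. -/
structure IsPreorderEquiv (f : A → B) : Prop where
  le_iff : ∀ a b, f a ≤ f b ↔ a ≤ b
  surj : ∀ b, ∃ a, PIso (f a) b

namespace IsPreorderEquiv

variable {f : A → B} (hf : IsPreorderEquiv f)

include hf

theorem monotone : Monotone f := fun a b h => (hf.le_iff a b).2 h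

theorem pIso_iff {a b : A} : PIso (f a) (f b) ↔ PIso a b :=
  and_congr (hf.le_iff _ _) (hf.le_iff _ _)

theorem isTop_iff {a : A} : IsTop (f a) ↔ IsTop a := by
  refine ⟨fun h b => (hf.le_iff _ _).1 (h _), fun h b => ?_⟩
  obtain ⟨c, hc⟩ := hf.surj b
  exact hc.2.trans (hf.monotone (h c))

theorem isBot_iff {a : A} : IsBot (f a) ↔ IsBot a := by
  refine ⟨fun h b => (hf.le_iff _ _).1 (h _), fun h b => ?_⟩
  obtain ⟨c, hc⟩ := hf.surj b
  exact (hf.monotone (h c)).trans hc.1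

theorem isGLB_iff {a b m : A} : IsGLB {f a, f b} (f m) ↔ IsGLB {a, b} m := by
  simp only [isGLB_pair_iff, hf.le_iff]
  refine and_congr Iff.rfl (and_congr Iff.rfl ⟨fun h c h₁ h₂ => ?_, fun h c h₁ h₂ => ?_⟩)
  · exact (hf.le_iff _ _).1 (h _ (hf.monotone h₁) (hf.monotone h₂))
  · obtain ⟨d, hd⟩ := hf.surj c
    exact hd.2.trans (hf.monotone (h d ((hf.le_iff _ _).1 (hd.1.trans h₁))
      ((hf.le_iff _ _).1 (hd.1.trans h₂))))

theorem isLUB_iff {a b m : A} : IsLUB {f a, f b} (f m) ↔ IsLUB {a, b} m := by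
  simp only [isLUB_pair_iff, hf.le_iff]
  refine and_congr Iff.rfl (and_congr Iff.rfl ⟨fun h c h₁ h₂ => ?_, fun h c h₁ h₂ => ?_⟩)
  · exact (hf.le_iff _ _).1 (h _ (hf.monotone h₁) (hf.monotone h₂))
  · obtain ⟨d, hd⟩ := hf.surj c
    exact (hf.monotone (h d ((hf.le_iff _ _).1 (h₁.trans hd.2))
      ((hf.le_iff _ _).1 (h₂.trans hd.2)))).trans hd.1

theorem isDistPrelatticeHom : IsDistPrelatticeHom f where
  monotone := hf.monotone
  map_top _ h := hf.isTop_iff.2 h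
  map_bot _ h := hf.isBot_iff.2 h
  map_meet _ _ _ h := hf.isGLB_iff.2 h
  map_join _ _ _ h := hf.isLUB_iff.2 h

theorem isDistPrelattice (hB : IsDistPrelattice B) : IsDistPrelattice A where
  exists_top := by
    obtain ⟨t, ht⟩ := hB.exists_top
    obtain ⟨s, hs⟩ := hf.surj t
    exact ⟨s, hf.isTop_iff.1 (hs.isTop_iff.2 ht)⟩
  exists_bot := by
    obtain ⟨t, ht⟩ := hB.exists_bot
    obtain ⟨s, hs⟩ := hf.surj t
    exact ⟨s, hf.isBot_iff.1 fun c => hs.1.trans (ht c)⟩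
  exists_meet a b := by
    obtain ⟨t, ht⟩ := hB.exists_meet (f a) (f b)
    obtain ⟨s, hs⟩ := hf.surj t
    exact ⟨s, hf.isGLB_iff.1 (IsGLB.of_pIso ht hs.symm)⟩
  exists_join a b := by
    obtain ⟨t, ht⟩ := hB.exists_join (f a) (f b)
    obtain ⟨s, hs⟩ := hf.surj t
    exact ⟨s, hf.isLUB_iff.1 (IsLUB.of_pIso ht hs.symm)⟩
  distrib a b c j m p q h₁ h₂ h₃ h₄ := hf.isLUB_iff.1 (hB.distrib _ _ _ _ _ _ _
    (hf.isLUB_iff.2 h₁) (hf.isGLB_iff.2 h₂) (hf.isGLB_iff.2 h₃) (hf.isGLB_iff.2 h₄))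

end IsPreorderEquiv

end Preorder

/-! ### Equivalences of indexed preorders -/

namespace IndexedPreorder

/-! ### The formal halves of Beck–Chevalley and Frobenius -/

section BeckChevalley

variable {C : Type u} [Category.{v} C] (P : IndexedPreorder.{u, v, w} C)

theorem pIso_of_comp_eq {A B K L : C} {π : A ⟶ B} {f : A ⟶ K} {g : B ⟶ L} {π' : K ⟶ L}
    (e : π ≫ g = f ≫ π') (a : P.pred L) :
    PIso (P.map π (P.map g a)) (P.map f (P.map π' a)) :=
  (P.map_comp π g a).symm.trans (e ▸ P.map_comp f π' a)

/-- This half of Beck–Chevalley is formal: it is the mate of the unit of `l'` and needs only a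
commuting square. The pullback property matters for the converse alone. -/
theorem leftAdjoint_map_le {A B K L : C} {π : A ⟶ B} {f : A ⟶ K} {g : B ⟶ L} {π' : K ⟶ L}
    (e : π ≫ g = f ≫ π') {l : P.pred A → P.pred B} {l' : P.pred K → P.pred L}
    (hl : GaloisConnection l (P.map π)) (hl' : GaloisConnection l' (P.map π')) (a : P.pred K) :
    l (P.map f a) ≤ P.map g (l' a) :=
  (hl _ _).2 ((P.map_mono f (hl'.le_u_l a)).trans (P.pIso_of_comp_eq e _).2)

theorem map_rightAdjoint_le {A B K L : C} {π : A ⟶ B} {f : A ⟶ K} {g : B ⟶ L} {π' : K ⟶ L}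
    (e : π ≫ g = f ≫ π') {r : P.pred A → P.pred B} {r' : P.pred K → P.pred L}
    (hr : GaloisConnection (P.map π) r) (hr' : GaloisConnection (P.map π') r') (a : P.pred K) :
    P.map g (r' a) ≤ r (P.map f a) :=
  (hr _ _).1 ((P.pIso_of_comp_eq e _).1.trans (P.map_mono f (hr'.l_u_le a)))

/-- The formal half of Frobenius: `m` lies below both factors, and `l` is monotone and adjoint to
reindexing. -/
theorem frobenius_le {A B : C} {π : B ⟶ A} {l : P.pred B → P.pred A}
    (hl : GaloisConnection l (P.map π)) {α : P.pred A} {β m : P.pred B} {n : P.pred A}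
    (hm : IsGLB {P.map π α, β} m) (hn : IsGLB {α, l β} n) : l m ≤ n := by
  rw [isGLB_pair_iff] at hm hn
  exact hn.2.2 _ ((hl _ _).2 hm.1) (hl.monotone_l hm.2.1)

end BeckChevalley

variable {C : Type u} [Category.{v} C] {D : Type u'} [Category.{v'} D]

theorem IsEq.pIso [HasFiniteProducts C] {P : IndexedPreorder.{u, v, w} C} {X : C}
    {e e' : P.pred (X ⨯ X)} (h : P.IsEq X e) (h' : P.IsEq X e') : PIso e e' :=
  ⟨(h _).1 ((h' _).2 le_rfl), (h' _).1 ((h _).2 le_rfl)⟩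

/-- An equivalence of indexed preorders over the same base. -/
structure IsEquiv (P : IndexedPreorder.{u, v, w} C) (Q : IndexedPreorder.{u, v, w'} C)
    (g : ∀ X, P.pred X → Q.pred X) : Prop where
  equiv : ∀ X, IsPreorderEquiv (g X)
  natural : ∀ {X Y : C} (f : X ⟶ Y) (a : P.pred Y), PIso (g X (P.map f a)) (Q.map f (g Y a))

namespace IsEquiv

variable {P : IndexedPreorder.{u, v, w} C} {Q : IndexedPreorder.{u, v, w'} C}
  {g : ∀ X, P.pred X → Q.pred X} (hg : IsEquiv P Q g)

include hg

/-- A pointwise choice of preimages is automatically monotone and natural up to isomorphism, because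
`g` reflects the order. It lets properties be transported in either direction. -/
theorem exists_inverse : ∃ h : ∀ X, Q.pred X → P.pred X,
    (∀ X b, PIso (g X (h X b)) b) ∧ IsEquiv Q P h := by
  choose h hh using fun X => (hg.equiv X).surj
  refine ⟨h, hh, fun X => ⟨fun a b => ?_, fun a => ⟨g X a, ?_⟩⟩, fun {X Y} f a => ?_⟩
  · rw [← (hg.equiv X).le_iff]
    exact (hh X a).le_iff (hh X b)
  · exact (hg.equiv X).pIso_iff.1 (hh X _)
  · refine (hg.equiv X).pIso_iff.1 ((hh X _).trans ?_)
    exact (PIso.map (Q.map_mono f) (hh Y a).symm).trans (hg.natural f _).symm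

theorem isEq_iff [HasFiniteProducts C] {X : C} {e : P.pred (X ⨯ X)} :
    Q.IsEq X (g _ e) ↔ P.IsEq X e := by
  refine ⟨fun h A => ?_, fun h A => ?_⟩
  · rw [← (hg.equiv _).le_iff, ← h, ← (hg.equiv _).isTop_iff]
    exact (hg.natural _ _).isTop_iff
  · obtain ⟨A', hA⟩ := (hg.equiv _).surj A
    rw [(PIso.rfl (a := g _ e)).le_iff hA.symm, (hg.equiv _).le_iff, ← h,
      ← (hg.equiv _).isTop_iff]
    exact ((PIso.map (Q.map_mono _) hA.symm).trans (hg.natural _ _).symm).isTop_iff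

theorem galoisConnection_left {X Y : C} {f : X ⟶ Y} {l : P.pred X → P.pred Y}
    {l' : Q.pred X → Q.pred Y} (h : GaloisConnection l' (Q.map f))
    (e : ∀ a, PIso (g Y (l a)) (l' (g X a))) : GaloisConnection l (P.map f) := fun a b => by
  rw [← (hg.equiv _).le_iff, (e a).le_iff PIso.rfl, h, ← (hg.equiv _).le_iff,
    (PIso.rfl (a := g X a)).le_iff (hg.natural f b)]

theorem galoisConnection_right {X Y : C} {f : X ⟶ Y} {r : P.pred X → P.pred Y}
    {r' : Q.pred X → Q.pred Y} (h : GaloisConnection (Q.map f) r')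
    (e : ∀ a, PIso (g Y (r a)) (r' (g X a))) : GaloisConnection (P.map f) r := fun b a => by
  rw [← (hg.equiv X).le_iff, (hg.natural f b).le_iff PIso.rfl, h, ← (hg.equiv Y).le_iff,
    (PIso.rfl (a := g Y b)).le_iff (e a)]

theorem exists_leftAdjoint_of {X Y : C} {f : X ⟶ Y}
    (h : ∃ l' : Q.pred X → Q.pred Y, GaloisConnection l' (Q.map f)) :
    ∃ l : P.pred X → P.pred Y, GaloisConnection l (P.map f) := by
  obtain ⟨l', hl'⟩ := h
  choose l hl using fun a => (hg.equiv Y).surj (l' (g X a))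
  exact ⟨l, hg.galoisConnection_left hl' hl⟩

theorem exists_rightAdjoint_of {X Y : C} {f : X ⟶ Y}
    (h : ∃ r' : Q.pred X → Q.pred Y, GaloisConnection (Q.map f) r') :
    ∃ r : P.pred X → P.pred Y, GaloisConnection (P.map f) r := by
  obtain ⟨r', hr'⟩ := h
  choose r hr using fun a => (hg.equiv Y).surj (r' (g X a))
  exact ⟨r, hg.galoisConnection_right hr' hr⟩

/-- The coherence axioms quantify over arbitrary left adjoints, so a given one on `P` must be
carried to `Q`. The compatibility is stated for any `b` isomorphic to `g X a`, since reindexing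
commutes with `g` only up to isomorphism. -/
theorem exists_leftAdjoint_extend {X Y : C} {f : X ⟶ Y} {l : P.pred X → P.pred Y}
    (hl : GaloisConnection l (P.map f)) : ∃ l' : Q.pred X → Q.pred Y,
      GaloisConnection l' (Q.map f) ∧ ∀ b a, PIso (g X a) b → PIso (g Y (l a)) (l' b) := by
  obtain ⟨h, hh, hh'⟩ := hg.exists_inverse
  have key : ∀ b a, PIso (g X a) b → PIso (g Y (l a)) (g Y (l (h X b))) := fun b a e =>
    PIso.map (hg.equiv Y).monotone (PIso.map hl.monotone_l
      ((hg.equiv X).pIso_iff.1 (e.trans (hh X b).symm)))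
  exact ⟨fun b => g Y (l (h X b)), hh'.galoisConnection_left hl fun b =>
    (hg.equiv Y).pIso_iff.1 (hh Y _), key⟩

theorem exists_rightAdjoint_extend {X Y : C} {f : X ⟶ Y} {r : P.pred X → P.pred Y}
    (hr : GaloisConnection (P.map f) r) : ∃ r' : Q.pred X → Q.pred Y,
      GaloisConnection (Q.map f) r' ∧ ∀ b a, PIso (g X a) b → PIso (g Y (r a)) (r' b) := by
  obtain ⟨h, hh, hh'⟩ := hg.exists_inverse
  have key : ∀ b a, PIso (g X a) b → PIso (g Y (r a)) (g Y (r (h X b))) := fun b a e =>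
    PIso.map (hg.equiv Y).monotone (PIso.map hr.monotone_u
      ((hg.equiv X).pIso_iff.1 (e.trans (hh X b).symm)))
  exact ⟨fun b => g Y (r (h X b)), hh'.galoisConnection_right hr fun b =>
    (hg.equiv Y).pIso_iff.1 (hh Y _), key⟩

/-- Coherence is invariant under equivalence of indexed preorders. -/
theorem isCoherent [HasFiniteProducts C] (hQ : Q.IsCoherent) : P.IsCoherent where
  distPrelattice X := (hg.equiv X).isDistPrelattice (hQ.distPrelattice X)
  map_hom {X Y} f :=
    { monotone := P.map_mono f
      map_top := fun t ht => (hg.equiv X).isTop_iff.1 ((hg.natural f t).isTop_iff.2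
        ((hQ.map_hom f).map_top _ ((hg.equiv Y).isTop_iff.2 ht)))
      map_bot := fun t ht => (hg.equiv X).isBot_iff.1 fun c => (hg.natural f t).1.trans
        ((hQ.map_hom f).map_bot _ ((hg.equiv Y).isBot_iff.2 ht) c)
      map_meet := fun a b m h => (hg.equiv X).isGLB_iff.1 (((((hQ.map_hom f).map_meet _ _ _
        ((hg.equiv Y).isGLB_iff.2 h)).of_pIso (hg.natural f m).symm).congr_pIso
        (hg.natural f a).symm (hg.natural f b).symm))
      map_join := fun a b m h => (hg.equiv X).isLUB_iff.1 (((((hQ.map_hom f).map_join _ _ _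
        ((hg.equiv Y).isLUB_iff.2 h)).of_pIso (hg.natural f m).symm).congr_pIso
        (hg.natural f a).symm (hg.natural f b).symm)) }
  exists_leftAdjoint π hπ := hg.exists_leftAdjoint_of (hQ.exists_leftAdjoint π hπ)
  beckChevalley_left {A B K L π f k π'} sq hπ hπ' l l' hl hl' a := by
    obtain ⟨m, hm, em⟩ := hg.exists_leftAdjoint_extend hl
    obtain ⟨m', hm', em'⟩ := hg.exists_leftAdjoint_extend hl'
    refine (hg.equiv B).pIso_iff.1 ((em _ _ (hg.natural f a)).trans
      ((hQ.beckChevalley_left sq hπ hπ' m m' hm hm' (g K a)).trans ?_))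
    exact (PIso.map (Q.map_mono k) (em' _ _ PIso.rfl).symm).trans (hg.natural k _).symm
  frobenius {B A} π hπ l hl α β m n h₁ h₂ := by
    obtain ⟨l', hl', el⟩ := hg.exists_leftAdjoint_extend hl
    refine (hg.equiv A).pIso_iff.1 ((el _ _ PIso.rfl).trans
      (hQ.frobenius π hπ l' hl' (g A α) (g B β) (g B m) (g A n) ?_ ?_))
    · exact ((hg.equiv B).isGLB_iff.2 h₁).congr_pIso (hg.natural π α) PIso.rfl
    · exact ((hg.equiv A).isGLB_iff.2 h₂).congr_pIso PIso.rfl (el _ _ PIso.rfl)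
  exists_eq X := by
    obtain ⟨e, he⟩ := hQ.exists_eq X
    obtain ⟨h, -, hh'⟩ := hg.exists_inverse
    exact ⟨h _ e, hh'.isEq_iff.2 he⟩
  eq_prod A B a b c ha hb hc := (hg.equiv _).isGLB_iff.1 ((hQ.eq_prod A B _ _ _
    (hg.isEq_iff.2 ha) (hg.isEq_iff.2 hb) (hg.isEq_iff.2 hc)).congr_pIso
    (hg.natural _ a).symm (hg.natural _ b).symm)

/-- Universal coherence is invariant under equivalence of indexed preorders. -/
theorem isUniversallyCoherent [HasFiniteProducts C] (hQ : Q.IsUniversallyCoherent) :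
    P.IsUniversallyCoherent where
  toIsCoherent := hg.isCoherent hQ.toIsCoherent
  exists_rightAdjoint π hπ := hg.exists_rightAdjoint_of (hQ.exists_rightAdjoint π hπ)
  beckChevalley_right {A B K L π f k π'} sq hπ hπ' r r' hr hr' a := by
    obtain ⟨m, hm, em⟩ := hg.exists_rightAdjoint_extend hr
    obtain ⟨m', hm', em'⟩ := hg.exists_rightAdjoint_extend hr'
    refine (hg.equiv B).pIso_iff.1 ((em _ _ (hg.natural f a)).trans
      ((hQ.beckChevalley_right sq hπ hπ' m m' hm hm' (g K a)).trans ?_))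
    exact (PIso.map (Q.map_mono k) (em' _ _ PIso.rfl).symm).trans (hg.natural k _).symm

end IsEquiv

/-! ### Equivalences with a change of base -/

theorem map_map_pIso_of_comp_eq_id (P : IndexedPreorder.{u, v, w} C) {X Y : C} {f : X ⟶ Y}
    {k : Y ⟶ X} (h : f ≫ k = 𝟙 X) (a : P.pred X) : PIso (P.map f (P.map k a)) a :=
  (P.map_comp f k a).symm.trans (by rw [h]; exact P.map_id a)

/-- Reindexing along an isomorphism is left adjoint to reindexing along its inverse. -/
theorem map_hom_le_iff (P : IndexedPreorder.{u, v, w} C) {X Y : C} (i : X ≅ Y) (a : P.pred Y)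
    (b : P.pred X) : P.map i.hom a ≤ b ↔ a ≤ P.map i.inv b :=
  ⟨fun h => (P.map_map_pIso_of_comp_eq_id i.inv_hom_id a).2.trans (P.map_mono _ h),
    fun h => (P.map_mono _ h).trans (P.map_map_pIso_of_comp_eq_id i.hom_inv_id b).1⟩

/-- A product-preserving functor `F` together with an equivalence of `P` with the base change of
`Q` along `F` is a morphism of universally coherent hyperdoctrines. -/
theorem IsEquiv.isUniversallyCoherentMorphism [HasFiniteProducts C] [HasFiniteProducts D]
    {P : IndexedPreorder.{u, v, w} C} {Q : IndexedPreorder.{u', v', w'} D} {F : C ⥤ D}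
    [PreservesFiniteProducts F] {η : ∀ X, P.pred X → Q.pred (F.obj X)}
    (hη : IsEquiv P (Q.baseChange F) η) : IsUniversallyCoherentMorphism P Q F η where
  preservesFiniteProducts := inferInstance
  hom X := (hη.equiv X).isDistPrelatticeHom
  natural f a := hη.natural f a
  map_exists {Y X} π _ l l' hl hl' a := by
    refine ⟨?_, (hl' _ _).2 (((hη.equiv Y).monotone (hl.le_u_l a)).trans (hη.natural π _).1)⟩
    -- Replacing `l' (η Y a)` by the isomorphic `η X c` brings it within reach of the adjunction on
    -- `P`.
    obtain ⟨c, hc⟩ := (hη.equiv X).surj (l' (η Y a))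
    refine le_trans ((hη.equiv X).monotone ((hl _ _).2 ((hη.equiv Y).le_iff _ _ |>.1 ?_))) hc.1
    exact (hl'.le_u_l _).trans ((Q.map_mono _ hc.2).trans (hη.natural π c).2)
  map_forall {Y X} π _ r r' hr hr' a := by
    refine ⟨(hr' _ _).1 ((hη.natural π _).2.trans ((hη.equiv Y).monotone (hr.l_u_le a))), ?_⟩
    obtain ⟨c, hc⟩ := (hη.equiv X).surj (r' (η Y a))
    refine le_trans hc.2 ((hη.equiv X).monotone ((hr _ _).1 ((hη.equiv Y).le_iff _ _ |>.1 ?_)))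
    exact (hη.natural π c).1.trans ((Q.map_mono _ hc.1).trans (hr'.l_u_le _))
  map_eq X e e' he he' := by
    -- The two candidates for equality have the same upper bounds of the form `η _ B`; since `η` is
    -- surjective up to isomorphism, they are then isomorphic.
    have key : ∀ B, η (X ⨯ X) e ≤ η (X ⨯ X) B ↔
        Q.map (prodComparison F X X) e' ≤ η (X ⨯ X) B := fun B => by
      have h := Q.map_hom_le_iff (asIso (prodComparison F X X)) e' (η _ B)
      rw [asIso_hom] at h
      -- The comparison isomorphism identifies the diagonal of `F X` with the image of the diagonal
      -- of `X`, so both truth conditions on diagonals coincide.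
      have e₁ : diag (F.obj X) ≫ inv (prodComparison F X X) = F.map (diag X) := by
        rw [IsIso.comp_inv_eq]
        refine Limits.prod.hom_ext ?_ ?_
        · rw [Category.assoc, prodComparison_fst, ← F.map_comp, prod.lift_fst, prod.lift_fst,
            F.map_id]
        · rw [Category.assoc, prodComparison_snd, ← F.map_comp, prod.lift_snd, prod.lift_snd,
            F.map_id]
      rw [h, ← he']
      refine ((hη.equiv _).le_iff _ _).trans ((he B).symm.trans ((hη.equiv _).isTop_iff.symm.trans
        (PIso.isTop_iff ((hη.natural (diag X) B).trans ?_))))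
      have := Q.map_comp (diag (F.obj X)) (inv (prodComparison F X X)) (η (X ⨯ X) B)
      rw [e₁] at this
      exact this
    obtain ⟨c, hc⟩ := (hη.equiv (X ⨯ X)).surj (Q.map (prodComparison F X X) e')
    exact ⟨le_trans ((key c).2 hc.2) hc.1, (key e).1 le_rfl⟩

end IndexedPreorder

/-! ### Infima and suprema in the unit interval -/

/-- The assumption `0 ≤ ε` covers empty `Y`, where the supremum in `[0,1]` is 0; dually, the next
lemma assumes `ε ≤ 1` because the empty infimum is 1. -/
theorem coe_iSup_le {Y : Type u} {F : Y → I} {ε : ℝ} (hε : 0 ≤ ε) (h : ∀ y, (F y : ℝ) ≤ ε) :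
    ((⨆ y, F y : I) : ℝ) ≤ ε := by
  rcases le_or_gt ε 1 with h1 | h1
  · exact Subtype.coe_le_coe.2 (iSup_le h : ⨆ y, F y ≤ (⟨ε, hε, h1⟩ : I))
  · exact (⨆ y, F y : I).2.2.trans h1.le

theorem le_coe_iInf {Y : Type u} {F : Y → I} {ε : ℝ} (hε : ε ≤ 1) (h : ∀ y, ε ≤ (F y : ℝ)) :
    ε ≤ ((⨅ y, F y : I) : ℝ) := by
  rcases le_or_gt 0 ε with h1 | h1
  · exact Subtype.coe_le_coe.2 (le_iInf h : (⟨ε, h1, hε⟩ : I) ≤ ⨅ y, F y)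
  · exact h1.le.trans (⨅ y, F y : I).2.1

theorem abs_iSup_sub_iSup_le {Y : Type u} {F H : Y → I} {ε : ℝ} (hε : 0 ≤ ε)
    (h : ∀ y, |(F y : ℝ) - H y| ≤ ε) : |((⨆ y, F y : I) : ℝ) - (⨆ y, H y : I)| ≤ ε := by
  have key : ∀ F H : Y → I, (∀ y, |(F y : ℝ) - H y| ≤ ε) →
      ((⨆ y, F y : I) : ℝ) ≤ (⨆ y, H y : I) + ε := fun F H h =>
    coe_iSup_le (add_nonneg (⨆ y, H y : I).2.1 hε) fun y => by
      have h1 : (H y : ℝ) ≤ (⨆ y, H y : I) := Subtype.coe_le_coe.2 (le_iSup H y)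
      linarith [(abs_le.1 (h y)).2]
  have h1 := key F H h
  have h2 := key H F fun y => by rw [abs_sub_comm]; exact h y
  exact abs_le.2 ⟨by linarith, by linarith⟩

theorem abs_iInf_sub_iInf_le {Y : Type u} {F H : Y → I} {ε : ℝ} (hε : 0 ≤ ε)
    (h : ∀ y, |(F y : ℝ) - H y| ≤ ε) : |((⨅ y, F y : I) : ℝ) - (⨅ y, H y : I)| ≤ ε := by
  have key : ∀ F H : Y → I, (∀ y, |(F y : ℝ) - H y| ≤ ε) →
      ((⨅ y, F y : I) : ℝ) - ε ≤ (⨅ y, H y : I) := fun F H h =>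
    le_coe_iInf (by linarith [(⨅ y, F y : I).2.2]) fun y => by
      have h1 : ((⨅ y, F y : I) : ℝ) ≤ F y := Subtype.coe_le_coe.2 (iInf_le F y)
      linarith [(abs_le.1 (h y)).2]
  have h1 := key F H h
  have h2 := key H F fun y => by rw [abs_sub_comm]; exact h y
  exact abs_le.2 ⟨by linarith, by linarith⟩

/-! ### Uniform continuity of functions to the unit interval -/

section UniformContinuous

variable {X : Type u} {Y : Type v} [PseudoMetricSpace X] [PseudoMetricSpace Y]

/-- The bound is made non-strict because only non-strict bounds survive infima and suprema. -/
theorem uniformContinuous_unitInterval_iff {f : X → I} : UniformContinuous f ↔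
    ∀ ε > 0, ∃ δ > 0, ∀ a b, dist a b < δ → |(f a : ℝ) - f b| ≤ ε := by
  rw [Metric.uniformContinuous_iff]
  refine ⟨fun h ε hε => ?_, fun h ε hε => ?_⟩
  · obtain ⟨δ, hδ, h'⟩ := h ε hε
    exact ⟨δ, hδ, fun a b hab => (h' hab).le⟩
  · obtain ⟨δ, hδ, h'⟩ := h (ε / 2) (half_pos hε)
    exact ⟨δ, hδ, fun {a b} hab => (h' a b hab).trans_lt (half_lt_self hε)⟩

theorem uniformContinuous_unitInterval_sup {f g : X → I} (hf : UniformContinuous f)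
    (hg : UniformContinuous g) : UniformContinuous fun x => f x ⊔ g x := by
  rw [uniformContinuous_unitInterval_iff] at *
  intro ε hε
  obtain ⟨δ, hδ, h⟩ := hf ε hε
  obtain ⟨δ', hδ', h'⟩ := hg ε hε
  exact ⟨min δ δ', lt_min hδ hδ', fun a b hab => (abs_max_sub_max_le_max _ _ _ _).trans
    (max_le (h a b (hab.trans_le (min_le_left _ _))) (h' a b (hab.trans_le (min_le_right _ _))))⟩

theorem uniformContinuous_unitInterval_inf {f g : X → I} (hf : UniformContinuous f)
    (hg : UniformContinuous g) : UniformContinuous fun x => f x ⊓ g x := by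
  rw [uniformContinuous_unitInterval_iff] at *
  intro ε hε
  obtain ⟨δ, hδ, h⟩ := hf ε hε
  obtain ⟨δ', hδ', h'⟩ := hg ε hε
  exact ⟨min δ δ', lt_min hδ hδ', fun a b hab => (abs_min_sub_min_le_max _ _ _ _).trans
    (max_le (h a b (hab.trans_le (min_le_left _ _))) (h' a b (hab.trans_le (min_le_right _ _))))⟩

/-- For the maximum metric, a modulus of `f` serves all `y` at once, and the infimum is 1-Lipschitz
for the uniform distance. -/
theorem uniformContinuous_iInf {f : X × Y → I} (hf : UniformContinuous f) :
    UniformContinuous fun x => ⨅ y, f (x, y) := by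
  rw [uniformContinuous_unitInterval_iff] at *
  intro ε hε
  obtain ⟨δ, hδ, h⟩ := hf ε hε
  exact ⟨δ, hδ, fun a b hab => abs_iInf_sub_iInf_le hε.le fun y => h _ _
    (by rw [Prod.dist_eq, dist_self]; exact max_lt hab hδ)⟩

theorem uniformContinuous_iSup {f : X × Y → I} (hf : UniformContinuous f) :
    UniformContinuous fun x => ⨆ y, f (x, y) := by
  rw [uniformContinuous_unitInterval_iff] at *
  intro ε hε
  obtain ⟨δ, hδ, h⟩ := hf ε hε
  exact ⟨δ, hδ, fun a b hab => abs_iSup_sub_iSup_le hε.le fun y => h _ _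
    (by rw [Prod.dist_eq, dist_self]; exact max_lt hab hδ)⟩

end UniformContinuous

/-- The pointwise minimum is the join in the fibres of `U`. -/
theorem U_isLUB {X : Type u} (α β : UPred X) :
    IsLUB {α, β} (fun x => α x ⊓ β x : UPred X) := by
  -- Sequences would require passing to subsequences here, since a minimum may tend to 0 although
  -- neither term does. Splitting on the smaller value point by point avoids this.
  refine isLUB_pair_iff.2 ⟨fun ε hε => ⟨ε, hε, fun x h => ?_⟩, fun ε hε => ⟨ε, hε, fun x h => ?_⟩,
    fun γ h₁ h₂ ε hε => ?_⟩
  · exact (Subtype.coe_le_coe.2 inf_le_left).trans h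
  · exact (Subtype.coe_le_coe.2 inf_le_right).trans h
  · obtain ⟨δ, hδ, h⟩ := h₁ ε hε
    obtain ⟨δ', hδ', h'⟩ := h₂ ε hε
    refine ⟨min δ δ', lt_min hδ hδ', fun x hx => ?_⟩
    rcases le_total (α x) (β x) with hab | hab
    · exact h x ((Subtype.coe_le_coe.2 (le_inf le_rfl hab)).trans (hx.trans (min_le_left _ _)))
    · exact h' x ((Subtype.coe_le_coe.2 (le_inf hab le_rfl)).trans (hx.trans (min_le_right _ _)))

/-- The pointwise supremum is the right adjoint to reindexing along a projection in `U`. -/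
theorem U_forall {X Y : Type u} :
    GaloisConnection (α := UPred X) (β := UPred (X × Y))
      (fun β p => β p.1) (fun F x => ⨆ y, F (x, y)) := by
  refine fun α F => ⟨fun h ε hε => ?_, fun h ε hε => ?_⟩
  · obtain ⟨δ, hδ, h'⟩ := h ε hε
    exact ⟨δ, hδ, fun x hx => coe_iSup_le hε.le fun y => h' (x, y) hx⟩
  · obtain ⟨δ, hδ, h'⟩ := h ε hε
    exact ⟨δ, hδ, fun p hp => (Subtype.coe_le_coe.2 (le_iSup (fun y => F (p.1, y)) p.2)).trans
      (h' p.1 hp)⟩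

theorem not_null_one : ¬ Null fun _ => (1 : I) := fun h => by
  obtain ⟨N, hN⟩ := h (1 / 2) (by norm_num)
  have := hN N le_rfl
  norm_num at this

theorem null_zero : Null fun _ => (0 : I) := fun _ hε => ⟨0, fun _ _ => hε.le⟩

/-! ### Products of metric spaces -/

namespace CMet1

/-- The first projection of the product with the maximum metric. -/
def fstHom (X Y : CMet1.{u}) : prodObj X Y ⟶ X := ⟨Prod.fst, uniformContinuous_fst⟩

/-- The second projection of the product with the maximum metric. -/
def sndHom (X Y : CMet1.{u}) : prodObj X Y ⟶ Y := ⟨Prod.snd, uniformContinuous_snd⟩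

/-- A point of a space as a morphism from the one-point space. -/
def point {X : CMet1.{u}} (x : X) : one.{u} ⟶ X := ⟨fun _ => x, uniformContinuous_const⟩

theorem val_congr {X Y : CMet1.{u}} {f g : X ⟶ Y} (h : f = g) (x : X) : f.1 x = g.1 x := by rw [h]

/-- An arbitrary product cone is identified with the explicit maximum-metric product, so its points
may be given by coordinates. The last clause says that coordinates determine the point. -/
theorem exists_pairing {P X Y : CMet1.{u}} {p : P ⟶ X} {q : P ⟶ Y}
    (h : IsLimit (BinaryFan.mk p q)) : ∃ m : prodObj X Y ⟶ P,
      (∀ z, p.1 (m.1 z) = z.1) ∧ (∀ z, q.1 (m.1 z) = z.2) ∧ ∀ t, m.1 (p.1 t, q.1 t) = t := by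
  obtain ⟨m, h₁, h₂⟩ := BinaryFan.IsLimit.lift' h (fstHom X Y) (sndHom X Y)
  refine ⟨m, val_congr h₁, val_congr h₂, fun t => ?_⟩
  let k : P ⟶ prodObj X Y := ⟨fun t => (p.1 t, q.1 t), p.2.prodMk q.2⟩
  have : k ≫ m = 𝟙 P := by
    refine BinaryFan.IsLimit.hom_ext h ?_ ?_
    · exact hom_ext fun t => val_congr h₁ (k.1 t)
    · exact hom_ext fun t => val_congr h₂ (k.1 t)
  exact val_congr this t

theorem exists_pairing_of_isProjection {P X : CMet1.{u}} {π : P ⟶ X} (h : IsProjection π) :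
    ∃ (Y : CMet1.{u}) (m : prodObj X Y ⟶ P), (∀ z, π.1 (m.1 z) = z.1) ∧
      ∀ t, ∃ y, m.1 (π.1 t, y) = t := by
  obtain ⟨Y, q, ⟨h⟩⟩ := h
  obtain ⟨m, h₁, -, h₂⟩ := exists_pairing h
  exact ⟨Y, m, h₁, fun t => ⟨_, h₂ t⟩⟩

/-- Points are morphisms from the one-point space, so the universal property yields them. -/
theorem exists_of_isPullback {A B K L : CMet1.{u}} {π : A ⟶ B} {f : A ⟶ K} {g : B ⟶ L}
    {π' : K ⟶ L} (sq : IsPullback π f g π') {b : B} {k : K} (h : g.1 b = π'.1 k) :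
    ∃ a, π.1 a = b ∧ f.1 a = k := by
  have e : point b ≫ g = point k ≫ π' := hom_ext fun _ => h
  exact ⟨(sq.lift _ _ e).1 PUnit.unit, val_congr (sq.lift_fst _ _ e) _,
    val_congr (sq.lift_snd _ _ e) _⟩

theorem S_prodObj {X Y : CMet1.{u}} (a b : ℕ → prodObj X Y) :
    (GFun.obj (prodObj X Y)).S a b ↔ (GFun.obj X).S (fun n => (a n).1) (fun n => (b n).1) ∧
      (GFun.obj Y).S (fun n => (a n).2) (fun n => (b n).2) :=
  null_sup (fun n => X.distI (a n).1 (b n).1) (fun n => Y.distI (a n).2 (b n).2)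

/-- The chosen product need not carry the maximum metric, but it is uniformly isomorphic to the
space that does, and uniformly continuous maps preserve equivalence of sequences. -/
theorem S_prod {X Y : CMet1.{u}} (a b : ℕ → (X ⨯ Y : CMet1.{u})) :
    (GFun.obj (X ⨯ Y)).S a b ↔
      (GFun.obj X).S (fun n => (prod.fst : X ⨯ Y ⟶ X).1 (a n))
        (fun n => (prod.fst : X ⨯ Y ⟶ X).1 (b n)) ∧
      (GFun.obj Y).S (fun n => (prod.snd : X ⨯ Y ⟶ Y).1 (a n))
        (fun n => (prod.snd : X ⨯ Y ⟶ Y).1 (b n)) := by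
  refine ⟨fun h => ⟨GFun.S_map _ h, GFun.S_map _ h⟩, fun h => ?_⟩
  obtain ⟨m, -, -, hm⟩ := exists_pairing (prodIsProd X Y)
  have := GFun.S_map m ((S_prodObj (fun n => ((prod.fst : X ⨯ Y ⟶ X).1 (a n),
    (prod.snd : X ⨯ Y ⟶ Y).1 (a n))) (fun n => ((prod.fst : X ⨯ Y ⟶ X).1 (b n),
    (prod.snd : X ⨯ Y ⟶ Y).1 (b n)))).2 h)
  simpa only [hm] using this

end CMet1

/-! ### The hyperdoctrine of uniformly continuous predicates -/

namespace CMT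

variable {X Y : CMet1.{u}}

theorem le_iff {φ ψ : CMT.pred X} : φ ≤ ψ ↔
    ∀ x : ℕ → X, (Null fun n => φ.1 (x n)) → Null fun n => ψ.1 (x n) :=
  entails_iff _ _

theorem isTop_iff {φ : CMT.pred X} : IsTop φ ↔ ∀ x : ℕ → X, Null fun n => φ.1 (x n) := by
  refine ⟨fun h x => ?_, fun h ψ => le_iff.2 fun x _ => h x⟩
  exact le_iff.1 (h ⟨fun _ => 0, uniformContinuous_const⟩) x null_zero

/-- The pointwise maximum. -/
def inf (φ ψ : CMT.pred X) : CMT.pred X :=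
  ⟨fun x => φ.1 x ⊔ ψ.1 x, uniformContinuous_unitInterval_sup φ.2 ψ.2⟩

/-- The pointwise minimum. -/
def sup (φ ψ : CMT.pred X) : CMT.pred X :=
  ⟨fun x => φ.1 x ⊓ ψ.1 x, uniformContinuous_unitInterval_inf φ.2 ψ.2⟩

theorem isGLB_inf (φ ψ : CMT.pred X) : IsGLB {φ, ψ} (inf φ ψ) := by
  have h := isGLB_pair_iff.1 (U_isGLB φ.1 ψ.1)
  exact isGLB_pair_iff.2 ⟨h.1, h.2.1, fun c => h.2.2 c.1⟩

theorem isLUB_sup (φ ψ : CMT.pred X) : IsLUB {φ, ψ} (sup φ ψ) := by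
  have h := isLUB_pair_iff.1 (U_isLUB φ.1 ψ.1)
  exact isLUB_pair_iff.2 ⟨h.1, h.2.1, fun c => h.2.2 c.1⟩

/-- The constant predicate `0`. -/
def top : CMT.pred X := ⟨fun _ => 0, uniformContinuous_const⟩

/-- The constant predicate `1`. -/
def bot : CMT.pred X := ⟨fun _ => 1, uniformContinuous_const⟩

theorem isTop_top : IsTop (top : CMT.pred X) := isTop_iff.2 fun _ => null_zero

theorem isBot_bot : IsBot (bot : CMT.pred X) := fun _ => le_iff.2 fun _ h => (not_null_one h).elim

theorem isDistPrelattice (X : CMet1.{u}) : IsDistPrelattice (CMT.pred X) :=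
  .of_ops isTop_top isBot_bot isGLB_inf isLUB_sup fun φ ψ χ =>
    le_of_eq (Subtype.ext (funext fun x => sup_inf_left (φ.1 x) (ψ.1 x) (χ.1 x)))

theorem isDistPrelatticeHom_map (f : X ⟶ Y) : IsDistPrelatticeHom (CMT.map f) :=
  .of_ops (t := top) (b := bot) (CMT.map_mono f) isTop_top isBot_bot isGLB_inf isLUB_sup
    (fun _ _ => (isGLB_pair_iff.1 (isGLB_inf (CMT.map f _) (CMT.map f _))).2.2)
    (fun _ _ => (isLUB_pair_iff.1 (isLUB_sup (CMT.map f _) (CMT.map f _))).2.2)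

/-- The adjoint is the infimum over the fibre. The extra clause extracts approximate witnesses lying
exactly over `x`. -/
theorem exists_leftAdjoint {π : Y ⟶ X} (hπ : IsProjection π) :
    ∃ l : CMT.pred Y → CMT.pred X, GaloisConnection l (CMT.map π) ∧
      ∀ (φ : CMT.pred Y) (x : ℕ → X), (Null fun n => (l φ).1 (x n)) → ∃ y : ℕ → Y, (∀ n, π.1 (y n) = x n) ∧
        Null fun n => φ.1 (y n) := by
  obtain ⟨Z, m, h₁, h₂⟩ := CMet1.exists_pairing_of_isProjection hπ
  refine ⟨fun φ => ⟨fun x => ⨅ z, φ.1 (m.1 (x, z)), uniformContinuous_iInf (φ.2.comp m.2)⟩,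
    fun φ α => (U_exists (fun z => φ.1 (m.1 z)) α.1).trans ⟨fun h ε hε => ?_, fun h ε hε => ?_⟩,
    fun φ x h => ?_⟩
  · obtain ⟨δ, hδ, h⟩ := h ε hε
    refine ⟨δ, hδ, fun y hy => ?_⟩
    obtain ⟨z, hz⟩ := h₂ y
    exact h (π.1 y, z) ((congrArg (fun t => (φ.1 t : ℝ)) hz).trans_le hy)
  · obtain ⟨δ, hδ, h⟩ := h ε hε
    refine ⟨δ, hδ, fun p hp => ?_⟩
    have := h _ hp
    rwa [show (CMT.map π α).1 (m.1 p) = α.1 p.1 from congrArg α.1 (h₁ p)] at this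
  · obtain ⟨z, hz⟩ := (null_iInf _).1 h
    exact ⟨_, fun n => h₁ (x n, z n), hz⟩

/-- Left adjoints are unique up to isomorphism, so witnesses exist for any of them, not only for the
explicit infimum. -/
theorem exists_of_leftAdjoint {π : Y ⟶ X} (hπ : IsProjection π) {l : CMT.pred Y → CMT.pred X}
    (hl : GaloisConnection l (CMT.map π)) {φ : CMT.pred Y} {x : ℕ → X}
    (h : Null fun n => (l φ).1 (x n)) :
    ∃ y : ℕ → Y, (∀ n, π.1 (y n) = x n) ∧ Null fun n => φ.1 (y n) := by
  obtain ⟨l', hl', k⟩ := exists_leftAdjoint hπ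
  exact k φ x (le_iff.1 ((hl _ _).2 (hl'.le_u_l φ)) x h)

theorem null_leftAdjoint {π : Y ⟶ X} {l : CMT.pred Y → CMT.pred X}
    (hl : GaloisConnection l (CMT.map π)) {φ : CMT.pred Y} {y : ℕ → Y} {x : ℕ → X}
    (h : Null fun n => φ.1 (y n)) (hx : ∀ n, π.1 (y n) = x n) : Null fun n => (l φ).1 (x n) := by
  obtain rfl : (fun n => π.1 (y n)) = x := funext hx
  exact le_iff.1 (hl.le_u_l φ) y h

/-- The adjoint is the supremum over the fibre. The extra clause bounds it at a single point, so
that one δ can serve all points in the Beck–Chevalley argument. -/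
theorem exists_rightAdjoint {π : Y ⟶ X} (hπ : IsProjection π) :
    ∃ r : CMT.pred Y → CMT.pred X, GaloisConnection (CMT.map π) r ∧
      ∀ φ x, ∀ ε ≥ 0, (∀ y, π.1 y = x → (φ.1 y : ℝ) ≤ ε) → ((r φ).1 x : ℝ) ≤ ε := by
  obtain ⟨Z, m, h₁, h₂⟩ := CMet1.exists_pairing_of_isProjection hπ
  refine ⟨fun φ => ⟨fun x => ⨆ z, φ.1 (m.1 (x, z)), uniformContinuous_iSup (φ.2.comp m.2)⟩,
    fun α φ => Iff.trans ⟨fun h ε hε => ?_, fun h ε hε => ?_⟩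
      (U_forall α.1 (fun z => φ.1 (m.1 z))),
    fun φ x ε hε h => coe_iSup_le hε fun z => h _ (h₁ _)⟩
  · obtain ⟨δ, hδ, h⟩ := h ε hε
    refine ⟨δ, hδ, fun p hp => h (m.1 p) ?_⟩
    rwa [show (CMT.map π α).1 (m.1 p) = α.1 p.1 from congrArg α.1 (h₁ p)]
  · obtain ⟨δ, hδ, h⟩ := h ε hε
    refine ⟨δ, hδ, fun y hy => ?_⟩
    obtain ⟨z, hz⟩ := h₂ y
    exact (congrArg (fun t => (φ.1 t : ℝ)) hz).symm.trans_le (h (π.1 y, z) hy)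

/-- The distance as a predicate on `X × X`. -/
noncomputable def eq (X : CMet1.{u}) : CMT.pred (X ⨯ X) :=
  ⟨fun p => X.distI ((prod.fst : X ⨯ X ⟶ X).1 p) ((prod.snd : X ⨯ X ⟶ X).1 p),
    ((prod.fst : X ⨯ X ⟶ X).2.dist (prod.snd : X ⨯ X ⟶ X).2).subtype_mk _⟩

theorem null_eq {p : ℕ → (X ⨯ X : CMet1.{u})} : (Null fun n => (eq X).1 (p n)) ↔
    (GFun.obj X).S (fun n => (prod.fst : X ⨯ X ⟶ X).1 (p n))
      (fun n => (prod.snd : X ⨯ X ⟶ X).1 (p n)) := Iff.rfl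

theorem fst_diag (x : X) : (prod.fst : X ⨯ X ⟶ X).1 ((diag X).1 x) = x :=
  CMet1.val_congr (prod.lift_fst (𝟙 X) (𝟙 X)) x

theorem snd_diag (x : X) : (prod.snd : X ⨯ X ⟶ X).1 ((diag X).1 x) = x :=
  CMet1.val_congr (prod.lift_snd (𝟙 X) (𝟙 X)) x

theorem isEq_eq (X : CMet1.{u}) : CMT.IsEq X (eq X) := fun A => by
  rw [isTop_iff, le_iff]
  refine ⟨fun h p hp => ?_, fun h x => h (fun n => (diag X).1 (x n)) (null_eq.2 ?_)⟩
  -- Compare `p n` with the diagonal point over its first coordinate: the coordinate distances are 0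
  -- and the distance between the two coordinates of `p n`, which tends to 0. Uniform continuity of
  -- `A` then carries truth from the diagonal to `p`.
  · refine (GFun.strictRel _ A).null_congr (a := fun n => (diag X).1 ((prod.fst : X ⨯ X ⟶ X).1
      (p n))) (h _) ((CMet1.S_prod _ _).2 ⟨?_, ?_⟩)
    · simp only [fst_diag]
      exact GFun.S_refl _ _
    · simp only [snd_diag]
      exact hp
  · simp only [fst_diag, snd_diag]
    exact GFun.S_refl _ _

theorem isUniversallyCoherent : CMT.{u}.IsUniversallyCoherent where
  distPrelattice := isDistPrelattice
  map_hom := isDistPrelatticeHom_map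
  exists_leftAdjoint _ hπ := (exists_leftAdjoint hπ).imp fun _ h => h.1
  exists_rightAdjoint _ hπ := (exists_rightAdjoint hπ).imp fun _ h => h.1
  beckChevalley_left {A B K L π f g π'} sq hπ hπ' l l' hl hl' φ := by
    refine ⟨IndexedPreorder.leftAdjoint_map_le _ sq.w hl hl' φ, le_iff.2 fun b hb => ?_⟩
    obtain ⟨k, hk, hφ⟩ := exists_of_leftAdjoint hπ' hl' hb
    choose a ha ha' using fun n => CMet1.exists_of_isPullback sq (hk n).symm
    refine null_leftAdjoint hl (φ := CMT.map f φ) (y := a) ?_ ha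
    obtain rfl : (fun n => f.1 (a n)) = k := funext ha'
    exact hφ
  beckChevalley_right {A B K L π f g π'} sq hπ hπ' r r' hr hr' φ := by
    refine ⟨?_, IndexedPreorder.map_rightAdjoint_le _ sq.w hr hr' φ⟩
    -- The explicit supremum lies below `r'`, so it is enough to bound it at `g b`. Each point of
    -- that fibre lifts to a point over `b`, where the counit of `r` gives the bound.
    obtain ⟨s, hs, h⟩ := exists_rightAdjoint hπ'
    refine le_trans ?_ (CMT.map_mono g ((hr' _ _).1 (hs.l_u_le φ)))
    intro ε hε
    obtain ⟨δ, hδ, h'⟩ := hr.l_u_le (CMT.map f φ) ε hε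
    refine ⟨δ, hδ, fun b hb => h φ _ ε hε.le fun k hk => ?_⟩
    obtain ⟨a, rfl, rfl⟩ := CMet1.exists_of_isPullback sq hk.symm
    exact h' a hb
  frobenius {B A} π hπ l hl α β m n hm hn := by
    refine ⟨IndexedPreorder.frobenius_le _ hl hm hn, le_iff.2 fun x hx => ?_⟩
    obtain ⟨h₁, h₂, -⟩ := isGLB_pair_iff.1 hn
    obtain ⟨y, hy, hβ⟩ := exists_of_leftAdjoint hπ hl (le_iff.1 h₂ x hx)
    refine null_leftAdjoint hl (le_iff.1 ((isGLB_pair_iff.1 hm).2.2 _ (isGLB_pair_iff.1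
      (isGLB_inf _ _)).1 (isGLB_pair_iff.1 (isGLB_inf _ _)).2.1) y ((null_sup _ _).2 ⟨?_, hβ⟩)) hy
    obtain rfl : (fun n => π.1 (y n)) = x := funext hy
    exact le_iff.1 h₁ _ hx
  exists_eq X := ⟨_, isEq_eq X⟩
  eq_prod A B a b c ha hb hc := by
    -- The distance on the product and the maximum of the coordinate distances need not agree, but
    -- they have the same null sequences.
    have h : ∀ p : ℕ → ((A ⨯ B) ⨯ (A ⨯ B) : CMet1.{u}), (Null fun n => (eq (A ⨯ B)).1 (p n)) ↔
        (Null fun n => (inf (CMT.map (prod.map prod.fst prod.fst) (eq A))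
          (CMT.map (prod.map prod.snd prod.snd) (eq B))).1 (p n)) := fun p => by
      refine (null_eq.trans (CMet1.S_prod _ _)).trans (Iff.trans (and_congr ?_ ?_)
        (null_sup _ _).symm)
      · refine Iff.trans (iff_of_eq ?_) null_eq.symm
        exact congrArg₂ _
          (funext fun n => (CMet1.val_congr (prod.map_fst prod.fst prod.fst) (p n)).symm)
          (funext fun n => (CMet1.val_congr (prod.map_snd prod.fst prod.fst) (p n)).symm)
      · refine Iff.trans (iff_of_eq ?_) null_eq.symm
        exact congrArg₂ _
          (funext fun n => (CMet1.val_congr (prod.map_fst prod.snd prod.snd) (p n)).symm)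
          (funext fun n => (CMet1.val_congr (prod.map_snd prod.snd prod.snd) (p n)).symm)
    have h' : PIso (eq (A ⨯ B)) (inf (CMT.map (prod.map prod.fst prod.fst) (eq A))
          (CMT.map (prod.map prod.snd prod.snd) (eq B))) :=
      ⟨le_iff.2 fun p => (h p).1, le_iff.2 fun p => (h p).2⟩
    exact ((isGLB_inf _ _).of_pIso (h'.symm.trans ((isEq_eq _).pIso hc))).congr_pIso
      (PIso.map (CMT.map_mono _) ((isEq_eq _).pIso ha))
      (PIso.map (CMT.map_mono _) ((isEq_eq _).pIso hb))

end CMT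

/-! ### Morphisms of partial equivalence relations acting on sequences -/

namespace PERU

variable {A B K L : PERU.{u}}

/-- The relation on sequences induced by a morphism. -/
def homS (f : A ⟶ B) (a : ℕ → A.carrier) (b : ℕ → B.carrier) : Prop := (exists_hom f).choose.S a b

/-- Equivalent functional relations have the same null sequences, so the choice of representative in
`homS` is immaterial. -/
theorem homS_hom (F : FunRel A B) {a : ℕ → A.carrier} {b : ℕ → B.carrier} :
    homS F.hom a b ↔ F.S a b :=
  have h := (exists_hom F.hom).choose_spec
  ⟨(hom_eq_iff _ _).1 h.symm a b, (hom_eq_iff _ _).1 h a b⟩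

theorem homS_id {a b : ℕ → A.carrier} : homS (𝟙 A) a b ↔ A.S a b := homS_hom (FunRel.id A)

theorem homS_comp {f : A ⟶ B} {g : B ⟶ K} {a : ℕ → A.carrier} {c : ℕ → K.carrier} :
    homS (f ≫ g) a c ↔ ∃ b, homS f a b ∧ homS g b c := by
  obtain ⟨F, rfl⟩ := exists_hom f
  obtain ⟨G, rfl⟩ := exists_hom g
  simp only [hom_comp, homS_hom, FunRel.comp_S]

theorem homS_ext {f g : A ⟶ B} (h : ∀ a b, homS f a b → homS g a b) : f = g := by
  obtain ⟨F, rfl⟩ := exists_hom f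
  obtain ⟨G, rfl⟩ := exists_hom g
  exact (hom_eq_iff _ _).2 fun a b => by simpa only [homS_hom] using h a b

section homS

variable {f : A ⟶ B} {a a' : ℕ → A.carrier} {b b' : ℕ → B.carrier}

theorem homS.left (h : homS f a b) : A.S a a := FunRel.S.left h

theorem homS.right (h : homS f a b) : B.S b b := FunRel.S.right h

theorem homS.congr (h : homS f a b) (ha : A.S a a') (hb : B.S b b') : homS f a' b' :=
  FunRel.S.congr h ha hb

theorem homS.unique (h : homS f a b) (h' : homS f a b') : B.S b b' := FunRel.S.unique h h'

theorem exists_homS (f : A ⟶ B) (h : A.S a a) : ∃ b, homS f a b := FunRel.exists_S _ h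

theorem homS.of_comp {g : B ⟶ K} {c : ℕ → K.carrier} (h : homS f a b) (h' : homS (f ≫ g) a c) :
    homS g b c := by
  obtain ⟨b', h₁, h₂⟩ := homS_comp.1 h'
  exact h₂.congr (h₁.unique h) h₂.right

end homS

/-! ### Pullbacks and products on sequences -/

section IsPullback

variable {π : A ⟶ B} {f : A ⟶ K} {g : B ⟶ L} {π' : K ⟶ L} (sq : IsPullback π f g π')

include sq

/-- The pairs `(b n, k n)` form a sequence in the explicit pullback `pb`; any value on it of the
comparison morphism to `A` will do. -/
theorem exists_homS_of_isPullback {b : ℕ → B.carrier} {k : ℕ → K.carrier} {l : ℕ → L.carrier}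
    (h : homS g b l) (h' : homS π' k l) : ∃ a, homS π a b ∧ homS f a k := by
  obtain ⟨G, rfl⟩ := exists_hom g
  obtain ⟨P, rfl⟩ := exists_hom π'
  rw [homS_hom] at h h'
  have hp : (pb G P).S (fun n => (b n, k n)) (fun n => (b n, k n)) :=
    (pb_S _ _ _ _).2 ⟨⟨h.left, h'.left⟩, l, h, h'⟩
  obtain ⟨a, ha⟩ := exists_homS (sq.lift _ _ (pb_condition G P)) hp
  refine ⟨a, ha.of_comp ?_, ha.of_comp ?_⟩
  · rw [sq.lift_fst]
    exact (homS_hom _).2 ((pbFst_S _ _ _ _).2 ⟨h.left, hp⟩)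
  · rw [sq.lift_snd]
    exact (homS_hom _).2 ((pbSnd_S _ _ _ _).2 ⟨h'.left, hp⟩)

/-- The comparison `i` into the explicit pullback relates both `a` and `a'` to the pairs `(b n, k
n)`, and following it by the comparison back gives the identity. -/
theorem S_of_isPullback {a a' : ℕ → A.carrier} {b : ℕ → B.carrier} {k : ℕ → K.carrier}
    (h₁ : homS π a b) (h₂ : homS f a k) (h₁' : homS π a' b) (h₂' : homS f a' k) : A.S a a' := by
  obtain ⟨G, rfl⟩ := exists_hom g
  obtain ⟨P, rfl⟩ := exists_hom π'
  let i := (isPullback_pb (F := G) (G := P)).lift _ _ sq.w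
  have e : i ≫ sq.lift _ _ (pb_condition G P) = 𝟙 A := by
    refine sq.hom_ext ?_ ?_
    · rw [Category.assoc, sq.lift_fst, isPullback_pb.lift_fst, Category.id_comp]
    · rw [Category.assoc, sq.lift_snd, isPullback_pb.lift_snd, Category.id_comp]
  have key : ∀ {a}, homS π a b → homS f a k → homS i a fun n => (b n, k n) := by
    intro a h h'
    obtain ⟨p, hp⟩ := exists_homS i h.left
    refine hp.congr h.left ((pb_S _ _ _ _).2 ⟨⟨?_, ?_⟩, ((pb_S _ _ _ _).1 hp.right).2⟩)
    · have := homS_comp.2 ⟨p, hp, (homS_hom (pbFst G P)).2 ((pbFst_S _ _ _ _).2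
        ⟨((pb_S _ _ _ _).1 hp.right).1.1, hp.right⟩)⟩
      rw [isPullback_pb.lift_fst] at this
      exact this.unique h
    · have := homS_comp.2 ⟨p, hp, (homS_hom (pbSnd G P)).2 ((pbSnd_S _ _ _ _).2
        ⟨((pb_S _ _ _ _).1 hp.right).1.2, hp.right⟩)⟩
      rw [isPullback_pb.lift_snd] at this
      exact this.unique h'
  obtain ⟨d, hd⟩ := exists_homS (sq.lift _ _ (pb_condition G P)) (key h₁ h₂).right
  have k₁ := homS_comp.2 ⟨_, key h₁ h₂, hd⟩
  have k₂ := homS_comp.2 ⟨_, key h₁' h₂', hd⟩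
  rw [e, homS_id] at k₁ k₂
  exact k₁.trans k₂.symm

end IsPullback

theorem S_prod {a a' : ℕ → (A ⨯ B : PERU.{u}).carrier} {b : ℕ → A.carrier} {k : ℕ → B.carrier}
    (h₁ : homS prod.fst a b) (h₂ : homS prod.snd a k) (h₁' : homS prod.fst a' b)
    (h₂' : homS prod.snd a' k) : (A ⨯ B).S a a' :=
  S_of_isPullback (IsPullback.of_is_product (prodIsProd A B) terminalIsTerminal) h₁ h₂ h₁' h₂'

theorem homS_diag {a : ℕ → A.carrier} {p : ℕ → (A ⨯ A : PERU.{u}).carrier} :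
    homS (diag A) a p ↔ homS prod.fst p a ∧ homS prod.snd p a := by
  have key : ∀ {p}, homS (diag A) a p → homS prod.fst p a ∧ homS prod.snd p a := fun h => by
    refine ⟨h.of_comp ?_, h.of_comp ?_⟩
    · rw [prod.lift_fst, homS_id]
      exact h.left
    · rw [prod.lift_snd, homS_id]
      exact h.left
  refine ⟨key, fun h => ?_⟩
  obtain ⟨q, hq⟩ := exists_homS (diag A) h.1.right
  exact hq.congr hq.left (S_prod (key hq).1 (key hq).2 h.1 h.2)

end PERU

/-! ### The doctrine of strict relations -/

namespace StrictRel

open PERU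

variable {A B K L : PERU.{u}}

theorem le_iff {φ ψ : StrictRel A} : φ ≤ ψ ↔
    ∀ a : ℕ → A.carrier, (Null fun n => φ.pred (a n)) → Null fun n => ψ.pred (a n) :=
  entails_iff _ _

theorem null_pullback (F : FunRel A B) (φ : StrictRel B) (a : ℕ → A.carrier) :
    (Null fun n => (φ.pullback F).pred (a n)) ↔ ∃ b, F.S a b ∧ Null fun n => φ.pred (b n) :=
  (null_iInf _).trans (exists_congr fun _ => null_sup _ _)

/-- Construct a strict relation from its set of sequences. -/
def ofSeq (p : UPred A.carrier) (h₁ : ∀ a : ℕ → A.carrier, (Null fun n => p (a n)) → A.S a a)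
    (h₂ : ∀ a b : ℕ → A.carrier, (Null fun n => p (a n)) → A.S a b → Null fun n => p (b n)) :
    StrictRel A where
  pred := p
  strict := (entails_iff _ _).2 h₁
  relational := (entails_iff _ _).2 fun x h =>
    h₂ (fun n => (x n).1) (fun n => (x n).2) ((null_sup _ _).1 h).1 ((null_sup _ _).1 h).2

/-- The true strict relation `x ∼ x`. -/
def top : StrictRel A :=
  ofSeq (fun x => A.rel (x, x)) (fun _ h => h) fun _ _ _ h => h.symm.trans h

/-- The false strict relation. -/
def bot : StrictRel A :=
  ofSeq (fun _ => 1) (fun _ h => (not_null_one h).elim) fun _ _ h => (not_null_one h).elim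

/-- The pointwise maximum. -/
def inf (φ ψ : StrictRel A) : StrictRel A :=
  ofSeq (fun x => φ.pred x ⊔ ψ.pred x) (fun _ h => φ.null_refl ((null_sup _ _).1 h).1)
    fun _ _ h k => (null_sup _ _).2
      ⟨φ.null_congr ((null_sup _ _).1 h).1 k, ψ.null_congr ((null_sup _ _).1 h).2 k⟩

/-- The pointwise minimum. -/
def sup (φ ψ : StrictRel A) : StrictRel A where
  pred x := φ.pred x ⊓ ψ.pred x
  strict := (isLUB_pair_iff.1 (U_isLUB φ.pred ψ.pred)).2.2 _ φ.strict ψ.strict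
  relational := by
    -- Conjunction with ∼ distributes over the minimum, so relationality may be checked on the two
    -- disjuncts separately.
    have h := isLUB_pair_iff.1 (U_isLUB (X := A.carrier × A.carrier)
      (fun p => φ.pred p.1 ⊔ A.rel (p.1, p.2)) (fun p => ψ.pred p.1 ⊔ A.rel (p.1, p.2)))
    have h' := isLUB_pair_iff.1 (U_isLUB (X := A.carrier × A.carrier)
      (fun p => φ.pred p.2) (fun p => ψ.pred p.2))
    have e : (fun p : A.carrier × A.carrier => (φ.pred p.1 ⊓ ψ.pred p.1) ⊔ A.rel (p.1, p.2) : UPred _) =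
        fun p : A.carrier × A.carrier => (φ.pred p.1 ⊔ A.rel (p.1, p.2)) ⊓ (ψ.pred p.1 ⊔ A.rel (p.1, p.2)) :=
      funext fun p => sup_inf_right _ _ _
    refine le_trans (α := UPred _) (le_of_eq e) (h.2.2 _ (le_trans (show _ ≤ _ from φ.relational) h'.1)
      (le_trans (show _ ≤ _ from ψ.relational) h'.2.1))

theorem isTop_iff {φ : StrictRel A} :
    IsTop φ ↔ ∀ a : ℕ → A.carrier, A.S a a → Null fun n => φ.pred (a n) :=
  ⟨fun h => le_iff.1 (h top), fun h ψ => le_iff.2 fun a ha => h a (ψ.null_refl ha)⟩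

theorem isTop_top : IsTop (top : StrictRel A) := isTop_iff.2 fun _ h => h

theorem isBot_bot : IsBot (bot : StrictRel A) := fun _ => le_iff.2 fun _ h => (not_null_one h).elim

theorem isGLB_inf (φ ψ : StrictRel A) : IsGLB {φ, ψ} (inf φ ψ) := by
  have h := isGLB_pair_iff.1 (U_isGLB φ.pred ψ.pred)
  exact isGLB_pair_iff.2 ⟨h.1, h.2.1, fun c => h.2.2 c.pred⟩

theorem isLUB_sup (φ ψ : StrictRel A) : IsLUB {φ, ψ} (sup φ ψ) := by
  have h := isLUB_pair_iff.1 (U_isLUB φ.pred ψ.pred)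
  exact isLUB_pair_iff.2 ⟨show φ.pred ≤ _ from h.1, show ψ.pred ≤ _ from h.2.1,
    fun c => h.2.2 c.pred⟩

theorem isDistPrelattice (A : PERU.{u}) : IsDistPrelattice (StrictRel A) :=
  .of_ops isTop_top isBot_bot isGLB_inf isLUB_sup fun φ ψ χ =>
    le_of_eq (α := UPred A.carrier) (funext fun x => sup_inf_left (φ.pred x) (ψ.pred x) (χ.pred x))

theorem pullback_mono (F : FunRel A B) : Monotone (pullback F) := fun φ ψ h => le_iff.2 fun a ha => by
  obtain ⟨b, hb, hφ⟩ := (null_pullback _ _ _).1 ha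
  exact (null_pullback _ _ _).2 ⟨b, hb, le_iff.1 h b hφ⟩

theorem isDistPrelatticeHom_pullback (F : FunRel A B) : IsDistPrelatticeHom (pullback F) := by
  refine .of_ops (t := top) (b := bot) (pullback_mono F) (isTop_iff.2 fun a ha => ?_)
    (fun c => le_iff.2 fun a ha => ?_) isGLB_inf isLUB_sup
    (fun φ ψ c h₁ h₂ => le_iff.2 fun a ha => ?_) (fun φ ψ c h₁ h₂ => ?_)
  · obtain ⟨b, hb⟩ := F.exists_S ha
    exact (null_pullback _ _ _).2 ⟨b, hb, hb.right⟩
  · obtain ⟨_, _, h⟩ := (null_pullback _ _ _).1 ha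
    exact (not_null_one h).elim
  · obtain ⟨b, hb, hφ⟩ := (null_pullback _ _ _).1 (le_iff.1 h₁ a ha)
    obtain ⟨b', hb', hψ⟩ := (null_pullback _ _ _).1 (le_iff.1 h₂ a ha)
    -- Single-valuedness makes the two witnesses equivalent, so `ψ` can be moved from `b'` to `b`.
    exact (null_pullback _ _ _).2
      ⟨b, hb, (null_sup _ _).2 ⟨hφ, ψ.null_congr hψ (hb'.unique hb)⟩⟩
  -- Reindexing preserves the minimum exactly: maximum with a fixed value and the infimum over `y`
  -- both distribute over it.
  · refine le_trans (le_of_eq (α := UPred A.carrier) (funext fun x => ?_))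
      ((isLUB_pair_iff.1 (isLUB_sup (pullback F φ) (pullback F ψ))).2.2 c h₁ h₂)
    refine Eq.trans ?_ iInf_inf_eq
    exact iInf_congr fun y => sup_inf_left _ _ _

/-- The image `∃ x, F(x, y) ∧ φ(x)` of a strict relation under a functional relation. -/
noncomputable def image (F : FunRel A B) (φ : StrictRel A) : StrictRel B :=
  ofSeq (fun y => ⨅ x, F.rel (x, y) ⊔ φ.pred x)
    (fun b h => by
      simp only [null_sup, null_iInf] at h
      obtain ⟨a, h, -⟩ := h
      exact FunRel.S.right h)
    (fun b b' h hb => by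
      simp only [null_sup, null_iInf] at h ⊢
      obtain ⟨a, h, h'⟩ := h
      exact ⟨a, FunRel.S.congr h (FunRel.S.left h) hb, h'⟩)

theorem null_image (F : FunRel A B) (φ : StrictRel A) (b : ℕ → B.carrier) :
    (Null fun n => (φ.image F).pred (b n)) ↔ ∃ a, F.S a b ∧ Null fun n => φ.pred (a n) :=
  (null_iInf _).trans (exists_congr fun _ => null_sup _ _)

/-- One direction is totality of `F`, the other single-valuedness. Left adjoints thus exist along
every morphism, in particular along diagonals. -/
theorem galoisConnection_image (F : FunRel A B) : GaloisConnection (image F) (pullback F) := by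
  refine fun φ ψ => ⟨fun h => le_iff.2 fun a ha => ?_, fun h => le_iff.2 fun b hb => ?_⟩
  · obtain ⟨b, hb⟩ := F.exists_S (φ.null_refl ha)
    exact (null_pullback _ _ _).2 ⟨b, hb, le_iff.1 h b ((null_image _ _ _).2 ⟨a, hb, ha⟩)⟩
  · obtain ⟨a, ha, hφ⟩ := (null_image _ _ _).1 hb
    obtain ⟨b', hb', hψ⟩ := (null_pullback _ _ _).1 (le_iff.1 h a hφ)
    exact ψ.null_congr hψ (hb'.unique ha)

/-- The indexed preorder of strict relations. -/
noncomputable def doctrine : IndexedPreorder.{u + 1, u, u} PERU.{u} where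
  pred := StrictRel
  map f := pullback (exists_hom f).choose
  map_mono f := pullback_mono _
  map_id φ := by
    refine ⟨le_iff.2 fun a ha => ?_, le_iff.2 fun a ha => ?_⟩
    · obtain ⟨b, hb, hφ⟩ := (null_pullback _ _ _).1 ha
      exact φ.null_congr hφ (homS_id.1 hb).symm
    · exact (null_pullback _ _ _).2 ⟨a, homS_id.2 (φ.null_refl ha), ha⟩
  map_comp f g φ := by
    refine ⟨le_iff.2 fun a ha => ?_, le_iff.2 fun a ha => ?_⟩
    · obtain ⟨c, hc, hφ⟩ := (null_pullback _ _ _).1 ha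
      obtain ⟨b, hb, hbc⟩ := homS_comp.1 hc
      exact (null_pullback _ _ _).2 ⟨b, hb, (null_pullback _ _ _).2 ⟨c, hbc, hφ⟩⟩
    · obtain ⟨b, hb, hφ⟩ := (null_pullback _ _ _).1 ha
      obtain ⟨c, hc, hφ⟩ := (null_pullback _ _ _).1 hφ
      exact (null_pullback _ _ _).2 ⟨c, homS_comp.2 ⟨b, hb, hc⟩, hφ⟩

theorem null_map {f : A ⟶ B} {φ : StrictRel B} {a : ℕ → A.carrier} :
    (Null fun n => (doctrine.map f φ : StrictRel A).pred (a n)) ↔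
      ∃ b, homS f a b ∧ Null fun n => φ.pred (b n) :=
  null_pullback _ _ _

/-! ### Left adjoints, equality and coherence for strict relations -/

section LeftAdjoint

variable {f : A ⟶ B} {l : StrictRel A → StrictRel B} (hl : GaloisConnection l (doctrine.map f))

include hl

theorem null_leftAdjoint {φ : StrictRel A} {b : ℕ → B.carrier} :
    (Null fun n => (l φ).pred (b n)) ↔ ∃ a, homS f a b ∧ Null fun n => φ.pred (a n) := by
  refine Iff.trans ?_ (null_image (exists_hom f).choose φ b)
  have h := galoisConnection_image (exists_hom f).choose
  exact ⟨le_iff.1 ((hl _ _).2 (h.le_u_l φ)) b, le_iff.1 ((h _ _).2 (hl.le_u_l φ)) b⟩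

end LeftAdjoint

theorem exists_leftAdjoint (f : A ⟶ B) :
    ∃ l : StrictRel A → StrictRel B, GaloisConnection l (doctrine.map f) :=
  ⟨_, galoisConnection_image _⟩

/-- Equality is the image of ⊤ along the diagonal, hence holds of the sequences whose two
projections share a value. -/
theorem isEq_iff {e : StrictRel (A ⨯ A)} : doctrine.IsEq A e ↔ ∀ p,
    (Null fun n => e.pred (p n)) ↔ ∃ a : ℕ → A.carrier, homS prod.fst p a ∧ homS prod.snd p a := by
  obtain ⟨l, hl⟩ := exists_leftAdjoint (diag A)
  have h₁ : doctrine.IsEq A (l top) := fun X =>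
    ⟨fun h => (hl _ _).2 (h _), fun h c => (isTop_top c).trans ((hl _ _).1 h)⟩
  have h₂ : ∀ p, (Null fun n => (l top).pred (p n)) ↔
      ∃ a : ℕ → A.carrier, homS prod.fst p a ∧ homS prod.snd p a := fun p => by
    refine (null_leftAdjoint hl).trans (exists_congr fun a => ?_)
    rw [homS_diag]
    exact ⟨fun h => h.1, fun h => ⟨h, h.1.right⟩⟩
  refine ⟨fun h p => ?_, fun h => ?_⟩
  · rw [← h₂]
    exact ⟨le_iff.1 (h.pIso h₁).1 p, le_iff.1 (h.pIso h₁).2 p⟩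
  · have k : PIso e (l top) :=
      ⟨le_iff.2 fun p hp => (h₂ p).2 ((h p).1 hp), le_iff.2 fun p hp => (h p).2 ((h₂ p).1 hp)⟩
    exact fun X => (h₁ X).trans (k.symm.le_iff PIso.rfl)

theorem isCoherent : doctrine.{u}.IsCoherent where
  distPrelattice := isDistPrelattice
  map_hom _ := isDistPrelatticeHom_pullback _
  exists_leftAdjoint π _ := exists_leftAdjoint π
  beckChevalley_left {A B K L π f g π'} sq _ _ l l' hl hl' φ := by
    refine ⟨IndexedPreorder.leftAdjoint_map_le _ sq.w hl hl' φ, le_iff.2 fun b hb => ?_⟩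
    obtain ⟨x, hx, h⟩ := null_map.1 hb
    obtain ⟨k, hk, hφ⟩ := (null_leftAdjoint hl').1 h
    obtain ⟨a, ha, ha'⟩ := exists_homS_of_isPullback sq hx hk
    exact (null_leftAdjoint hl).2 ⟨a, ha, null_map.2 ⟨k, ha', hφ⟩⟩
  frobenius {B A} π _ l hl α β m n hm hn := by
    refine ⟨IndexedPreorder.frobenius_le _ hl hm hn, le_iff.2 fun x hx => ?_⟩
    obtain ⟨h₁, h₂, -⟩ := isGLB_pair_iff.1 hn
    obtain ⟨y, hy, hβ⟩ := (null_leftAdjoint hl).1 (le_iff.1 h₂ x hx)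
    have h := isGLB_pair_iff.1 (isGLB_inf (doctrine.map π α) β)
    exact (null_leftAdjoint hl).2 ⟨y, hy, le_iff.1 ((isGLB_pair_iff.1 hm).2.2 _ h.1 h.2.1) y
      ((null_sup _ _).2 ⟨null_map.2 ⟨x, hy, le_iff.1 h₁ x hx⟩, hβ⟩)⟩
  exists_eq X := by
    obtain ⟨l, hl⟩ := exists_leftAdjoint (diag X)
    exact ⟨l top, fun X =>
      ⟨fun h => (hl _ _).2 (h _), fun h c => (isTop_top c).trans ((hl _ _).1 h)⟩⟩
  eq_prod A B a b c ha hb hc := by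
    refine (isGLB_inf _ _).of_pIso ?_
    have h : ∀ p : ℕ → ((A ⨯ B) ⨯ (A ⨯ B) : PERU.{u}).carrier, (Null fun n => c.pred (p n)) ↔ Null fun n => (inf
        (doctrine.map (prod.map prod.fst prod.fst) a)
        (doctrine.map (prod.map prod.snd prod.snd) b)).pred (p n) := fun p => by
      refine (isEq_iff.1 hc p).trans (Iff.trans ?_ ((null_sup _ _).trans (and_congr
        (null_map.trans (exists_congr fun q => and_congr_right fun _ => isEq_iff.1 ha q))
        (null_map.trans (exists_congr fun q => and_congr_right fun _ => isEq_iff.1 hb q)))).symm)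
      constructor
      · rintro ⟨d, h₁, h₂⟩
        obtain ⟨x, hx⟩ := exists_homS prod.fst h₁.right
        obtain ⟨y, hy⟩ := exists_homS prod.snd h₁.right
        obtain ⟨q, hq⟩ := exists_homS (prod.map prod.fst prod.fst) h₁.left
        obtain ⟨r, hr⟩ := exists_homS (prod.map prod.snd prod.snd) h₁.left
        refine ⟨⟨q, hq, x, hq.of_comp ?_, hq.of_comp ?_⟩, ⟨r, hr, y, hr.of_comp ?_, hr.of_comp ?_⟩⟩
        · rw [prod.map_fst]
          exact homS_comp.2 ⟨d, h₁, hx⟩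
        · rw [prod.map_snd]
          exact homS_comp.2 ⟨d, h₂, hx⟩
        · rw [prod.map_fst]
          exact homS_comp.2 ⟨d, h₁, hy⟩
        · rw [prod.map_snd]
          exact homS_comp.2 ⟨d, h₂, hy⟩
      · rintro ⟨⟨q, hq, x, hx, hx'⟩, ⟨r, hr, y, hy, hy'⟩⟩
        obtain ⟨d, hd⟩ := exists_homS prod.fst hq.left
        obtain ⟨d', hd'⟩ := exists_homS prod.snd hq.left
        -- The two halves `d` and `d'` of `p` have the same components `x` and `y`, so they are
        -- equivalent in the product.
        refine ⟨d, hd, hd'.congr hq.left (S_prod (b := x) (k := y) ?_ ?_ ?_ ?_)⟩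
        · refine hd'.of_comp ?_
          rw [← prod.map_snd (prod.fst : A ⨯ B ⟶ A) prod.fst]
          exact homS_comp.2 ⟨q, hq, hx'⟩
        · refine hd'.of_comp ?_
          rw [← prod.map_snd (prod.snd : A ⨯ B ⟶ B) prod.snd]
          exact homS_comp.2 ⟨r, hr, hy'⟩
        · refine hd.of_comp ?_
          rw [← prod.map_fst prod.fst (prod.fst : A ⨯ B ⟶ A)]
          exact homS_comp.2 ⟨q, hq, hx⟩
        · refine hd.of_comp ?_
          rw [← prod.map_fst prod.snd (prod.snd : A ⨯ B ⟶ B)]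
          exact homS_comp.2 ⟨r, hr, hy⟩
    exact ⟨le_iff.2 fun p => (h p).2, le_iff.2 fun p => (h p).1⟩

/-! ### Strict relations and subobjects -/

theorem homS_incl {φ : StrictRel A} {a b : ℕ → A.carrier} :
    homS φ.incl.hom a b ↔ (Null fun n => φ.pred (a n)) ∧ A.S a b :=
  (homS_hom _).trans (obj_S φ a b)

/-- A morphism factors through the inclusion of `φ` if its values satisfy `φ`. -/
theorem exists_factor_iff {φ : StrictRel B} {f : A ⟶ B} : (∃ g, g ≫ φ.incl.hom = f) ↔
    ∀ a b, homS f a b → Null fun n => φ.pred (b n) := by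
  constructor
  · rintro ⟨g, rfl⟩ a b h
    obtain ⟨c, -, h₂⟩ := homS_comp.1 h
    exact φ.null_congr (homS_incl.1 h₂).1 (homS_incl.1 h₂).2
  · intro h
    obtain ⟨F, rfl⟩ := exists_hom f
    simp only [homS_hom] at h
    have hS : ∀ {a b b'}, F.S a b → B.S b b' → φ.obj.S b b' := fun h₁ h₂ =>
      (obj_S _ _ _).2 ⟨h _ _ h₁, h₂⟩
    -- The same relation `F`, regarded as landing in the smaller object; the hypothesis provides
    -- strictness there.
    let k : FunRel A φ.obj := FunRel.ofSeq (B := φ.obj) F.rel F.S (fun _ _ => Iff.rfl)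
      (fun _ _ h₁ => ⟨h₁.left, hS h₁ h₁.right⟩)
      (fun _ _ _ _ h₁ h₂ h₃ => h₁.congr h₂ ((obj_S _ _ _).1 h₃).2)
      (fun _ _ _ h₁ h₂ => hS h₁ (h₁.unique h₂)) (fun _ h₁ => F.exists_S h₁)
    refine ⟨k.hom, homS_ext fun a b hab => ?_⟩
    obtain ⟨c, h₁, h₂⟩ := homS_comp.1 hab
    have h₁ : F.S a c := (homS_hom k).1 h₁
    exact (homS_hom F).2 (h₁.congr h₁.left (homS_incl.1 h₂).2)

theorem mk_le_toSubobject_iff {φ : StrictRel B} {f : A ⟶ B} [Mono f] :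
    Subobject.mk f ≤ φ.toSubobject ↔ ∀ a b, homS f a b → Null fun n => φ.pred (b n) := by
  rw [← exists_factor_iff]
  exact ⟨fun h => ⟨_, Subobject.ofMkLEMk_comp h⟩, fun ⟨g, h⟩ => Subobject.mk_le_mk_of_comm g h⟩

theorem toSubobject_le_iff {φ ψ : StrictRel A} : φ.toSubobject ≤ ψ.toSubobject ↔ φ ≤ ψ := by
  rw [toSubobject, mk_le_toSubobject_iff, le_iff]
  refine ⟨fun h a ha => h a a (homS_incl.2 ⟨ha, φ.null_refl ha⟩), fun h a b hab => ?_⟩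
  exact ψ.null_congr (h a (homS_incl.1 hab).1) (homS_incl.1 hab).2

/-- The projections of the kernel pair of a mono coincide; evaluate them at the sequence of pairs
`(a n, a' n)`. -/
theorem S_of_mono {f : A ⟶ B} [Mono f] {a a' : ℕ → A.carrier} {b : ℕ → B.carrier}
    (h : homS f a b) (h' : homS f a' b) : A.S a a' := by
  obtain ⟨F, rfl⟩ := exists_hom f
  rw [homS_hom] at h h'
  have e := (hom_eq_iff _ _).1 ((cancel_mono F.hom).1 (pb_condition F F)) (fun n => (a n, a' n)) a
    ((pbFst_S _ _ _ _).2 ⟨h.left, (pb_S _ _ _ _).2 ⟨⟨h.left, h'.left⟩, b, h, h'⟩⟩)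
  exact ((pbSnd_S _ _ _ _).1 e).1.symm

theorem toSubobject_surjective (s : Subobject A) : ∃ φ : StrictRel A, φ.toSubobject = s := by
  induction s using Subobject.ind with | _ f
  rename_i B _
  obtain ⟨F, hF⟩ := exists_hom f
  have hf : ∀ {a b}, F.S a b ↔ homS f a b := by
    subst hF
    exact (homS_hom F).symm
  -- The candidate is the image of the mono, the predicate `∃ x, F(x, y)`.
  let φ : StrictRel A := image F top
  have hφ : ∀ {a}, (Null fun n => φ.pred (a n)) ↔ ∃ b, F.S b a := fun {a} =>
    (null_image F top a).trans (exists_congr fun b => ⟨fun h => h.1, fun h => ⟨h, h.left⟩⟩)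
  refine ⟨φ, le_antisymm ?_ (mk_le_toSubobject_iff.2 fun a b h => hφ.2 ⟨a, hf.2 h⟩)⟩
  -- The converse of `F`: it is total because `φ` is the image, and single-valued because `f` is
  -- mono.
  let k : FunRel φ.obj B := FunRel.ofSeq (A := φ.obj) (fun p => F.rel (p.2, p.1))
    (fun a b => F.S b a) (fun _ _ => Iff.rfl)
    (fun a b h => ⟨(obj_S _ _ _).2 ⟨hφ.2 ⟨b, h⟩, h.right⟩, h.left⟩)
    (fun _ _ _ _ h₁ h₂ h₃ => h₁.congr h₃ ((obj_S _ _ _).1 h₂).2)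
    (fun _ _ _ h₁ h₂ => S_of_mono (hf.1 h₁) (hf.1 h₂)) (fun _ h => hφ.1 ((obj_S _ _ _).1 h).1)
  refine Subobject.mk_le_mk_of_comm k.hom (homS_ext fun a b hab => ?_)
  obtain ⟨c, h₁, h₂⟩ := homS_comp.1 hab
  have h₁ : F.S c a := (homS_hom k).1 h₁
  exact homS_incl.2 ⟨hφ.2 ⟨c, h₁⟩, h₁.unique (hf.2 h₂)⟩

/-- Both sides have the same strict relations `ψ` below them, and these exhaust the subobjects.
Lying below the pullback means that the inclusion of `ψ` followed by `F` factors through `φ`, which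
is a condition on sequences. -/
theorem pullback_toSubobject (F : FunRel A B) (φ : StrictRel B) :
    (Subobject.pullback F.hom).obj φ.toSubobject = (φ.pullback F).toSubobject := by
  have key : ∀ ψ : StrictRel A, ψ.toSubobject ≤ (Subobject.pullback F.hom).obj φ.toSubobject ↔
      ψ.toSubobject ≤ (φ.pullback F).toSubobject := by
    intro ψ
    have h₁ : ψ.toSubobject ≤ (Subobject.pullback F.hom).obj φ.toSubobject ↔
        ∃ g, g ≫ φ.incl.hom = ψ.incl.hom ≫ F.hom := by
      rw [toSubobject, toSubobject,
        Subobject.pullback_obj_mk (IsPullback.of_hasPullback φ.incl.hom F.hom)]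
      refine ⟨fun h => ⟨Subobject.ofMkLEMk _ _ h ≫ Limits.pullback.fst _ _, ?_⟩, fun ⟨g, h⟩ =>
        Subobject.mk_le_mk_of_comm (Limits.pullback.lift g ψ.incl.hom h)
          (Limits.pullback.lift_snd _ _ _)⟩
      rw [Category.assoc, Limits.pullback.condition, ← Category.assoc, Subobject.ofMkLEMk_comp]
    rw [h₁, exists_factor_iff, toSubobject_le_iff, le_iff]
    constructor
    · intro h a ha
      obtain ⟨b, hb⟩ := F.exists_S (ψ.null_refl ha)
      exact (null_pullback _ _ _).2 ⟨b, hb, h a b (homS_comp.2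
        ⟨a, homS_incl.2 ⟨ha, ψ.null_refl ha⟩, (homS_hom F).2 hb⟩)⟩
    · intro h a b hab
      obtain ⟨a', h₁, h₂⟩ := homS_comp.1 hab
      obtain ⟨b', hb', hφ⟩ := (null_pullback _ _ _).1 (h a (homS_incl.1 h₁).1)
      rw [homS_hom] at h₂
      exact φ.null_congr hφ ((hb'.congr (homS_incl.1 h₁).2 hb'.right).unique h₂)
  obtain ⟨χ, hχ⟩ := toSubobject_surjective ((Subobject.pullback F.hom).obj φ.toSubobject)
  exact le_antisymm (hχ ▸ (key χ).1 hχ.le) ((key _).2 le_rfl)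

theorem isEquiv_toSubobject : IndexedPreorder.IsEquiv doctrine.{u} (subobjectDoctrine PERU.{u})
    fun _ => toSubobject where
  equiv _ := ⟨fun _ _ => toSubobject_le_iff, fun s => by
    obtain ⟨φ, rfl⟩ := toSubobject_surjective s
    exact ⟨φ, PIso.rfl⟩⟩
  natural f φ := by
    have h := pullback_toSubobject (exists_hom f).choose φ
    rw [← (exists_hom f).choose_spec] at h
    exact ⟨h.ge, h.le⟩

end StrictRel

theorem isCoherent_subobjectDoctrine : (subobjectDoctrine PERU.{u}).IsCoherent := by
  obtain ⟨_, -, h⟩ := StrictRel.isEquiv_toSubobject.exists_inverse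
  exact h.isCoherent StrictRel.isCoherent

/-! ### The functor to partial equivalence relations -/

namespace GFun

open PERU

variable {X Y : CMet1.{u}}

theorem map_S (f : X ⟶ Y) {a : ℕ → X} {b : ℕ → Y} :
    (map f).S a b ↔ (obj Y).S (fun n => f.1 (a n)) b := Iff.rfl

theorem homS_map (f : X ⟶ Y) {a : ℕ → X} {b : ℕ → Y} :
    homS (G.map f) a b ↔ (obj Y).S (fun n => f.1 (a n)) b := homS_hom (map f)

theorem eq_zero_of_null_const {c : I} (h : Null fun _ => c) : c = 0 :=
  le_antisymm (Subtype.coe_le_coe.1 (le_of_forall_pos_le_add fun ε hε => by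
    obtain ⟨N, hN⟩ := h ε hε
    simpa using hN N le_rfl)) bot_le

theorem eq_of_S_const {x y : X} (h : (obj X).S (fun _ => x) (fun _ => y)) : x = y :=
  dist_eq_zero.1 (congrArg Subtype.val (eq_zero_of_null_const h))

/-- The hypothesis is the sequential form of the entailment from `d(x, x')` to `d(f x, f x')`, and
that entailment is uniform continuity. -/
theorem uniformContinuous_of_S {f : X → Y} (h : ∀ a b, (obj X).S a b →
    (obj Y).S (fun n => f (a n)) (fun n => f (b n))) : UniformContinuous f := by
  have key : Entails (X := X × X) (fun p => X.distI p.1 p.2) (fun p => Y.distI (f p.1) (f p.2)) :=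
    (entails_iff _ _).2 fun p => h (fun n => (p n).1) fun n => (p n).2
  refine Metric.uniformContinuous_iff.2 fun ε hε => ?_
  obtain ⟨δ, hδ, h'⟩ := key (ε / 2) (half_pos hε)
  exact ⟨δ, hδ, fun {a b} hab => (h' (a, b) hab.le).trans_lt (half_lt_self hε)⟩

/-- Completeness of `Y` makes every functional relation `X → Y` the graph of a function. -/
theorem exists_rel_eq_zero (F : FunRel (obj X) (obj Y)) (x : X) : ∃ y : Y, F.rel (x, y) = 0 := by
  obtain ⟨b, hb⟩ := F.exists_S (S_refl X fun _ => x)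
  -- Single-valuedness at the fixed `x` bounds `d(b n, b N)` once `F(x, b n)` and `F(x, b N)` are
  -- small.
  have hc : CauchySeq (show ℕ → Y from b) := Metric.cauchySeq_iff'.2 fun ε hε => by
    obtain ⟨δ, hδ, h⟩ := F.singleValued (ε / 2) (half_pos hε)
    obtain ⟨N, hN⟩ := hb δ hδ
    exact ⟨N, fun n hn => (h (x, b n, b N) (max_le (hN n hn) (hN N le_rfl))).trans_lt
      (half_lt_self hε)⟩
  obtain ⟨y, hy⟩ := cauchySeq_tendsto_of_complete hc
  -- The sequence `b` is equivalent to the constant sequence at its limit, so the constant `F(x, y)`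
  -- tends to 0.
  refine ⟨y, eq_zero_of_null_const (show F.S (fun _ => x) (fun _ => y) from
    hb.congr (S_refl X _) fun ε hε => ?_)⟩
  obtain ⟨N, hN⟩ := Metric.tendsto_atTop.1 hy ε hε
  exact ⟨N, fun n hn => (hN n hn).le⟩

end GFun

open PERU GFun

theorem full_G : G.{u}.Full where
  map_surjective {X Y} h := by
    obtain ⟨F, rfl⟩ := exists_hom h
    choose f hf using exists_rel_eq_zero (X := X) (Y := Y) F
    have hS : ∀ a : ℕ → X, F.S a fun n => f (a n) := fun a ε hε =>
      ⟨0, fun n _ => (congrArg Subtype.val (hf (a n))).trans_le hε.le⟩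
    -- If `a` and `b` are equivalent, then `F` relates `b` to both `f ∘ a` and `f ∘ b`, so
    -- single-valuedness gives uniform continuity.
    refine ⟨⟨f, uniformContinuous_of_S fun a b h =>
      ((hS a).congr h (S_refl Y _)).unique (hS b)⟩, (hom_eq_iff _ _).2 fun a b h => ?_⟩
    exact (hS a).congr (S_refl X a) h

theorem faithful_G : G.{u}.Faithful where
  map_injective {_ Y f g} h := CMet1.hom_ext fun x =>
    (eq_of_S_const (X := Y) ((homS_map g (a := fun _ => x) (b := fun _ => f.1 x)).1
      (h ▸ (homS_map f).2 (S_refl Y _)))).symm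

/-- The one-point space is terminal. -/
def CMet1.isTerminalOne : IsTerminal CMet1.one.{u} :=
  IsTerminal.ofUniqueHom (fun _ => ⟨fun _ => PUnit.unit, uniformContinuous_const⟩)
    fun _ _ => CMet1.hom_ext fun _ => rfl

/-- The image of the one-point space is terminal. -/
noncomputable def isTerminalGOne : IsTerminal (G.obj CMet1.one.{u}) :=
  IsTerminal.ofUniqueHom
    (fun A => FunRel.hom (FunRel.ofSeq (A := A) (B := GFun.obj CMet1.one) (fun p => A.rel (p.1, p.1))
      (fun a _ => A.S a a) (fun _ _ => Iff.rfl) (fun _ _ h => ⟨h, S_refl _ _⟩)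
      (fun _ _ _ _ _ h _ => h.symm.trans h) (fun _ _ _ _ _ => S_refl CMet1.one _)
      (fun _ h => ⟨fun _ => PUnit.unit, h⟩)))
    (fun _ _ => homS_ext fun _ _ h => (homS_hom _).2 (homS.left h))

/-! ### Preservation of finite products by `G` -/

section prod

variable {X Y : CMet1.{u}}

/-- The pairing of two functional relations into a product of metric spaces. -/
noncomputable def prodLift {T : PERU.{u}} (P : FunRel T (GFun.obj X)) (Q : FunRel T (GFun.obj Y)) :
    FunRel T (GFun.obj (X ⨯ Y)) :=
  FunRel.ofSeq (B := GFun.obj (X ⨯ Y))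
    (fun p => P.rel (p.1, (prod.fst : X ⨯ Y ⟶ X).1 p.2) ⊔ Q.rel (p.1, (prod.snd : X ⨯ Y ⟶ Y).1 p.2))
    (fun t p => P.S t (fun n => (prod.fst : X ⨯ Y ⟶ X).1 (p n)) ∧
      Q.S t (fun n => (prod.snd : X ⨯ Y ⟶ Y).1 (p n)))
    (fun _ _ => null_sup _ _) (fun _ _ h => ⟨h.1.left, S_refl _ _⟩)
    (fun _ _ _ _ h ht hp => ⟨h.1.congr ht (S_map _ hp), h.2.congr ht (S_map _ hp)⟩)
    (fun _ _ _ h h' => (CMet1.S_prod _ _).2 ⟨h.1.unique h'.1, h.2.unique h'.2⟩)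
    (fun t ht => by
      obtain ⟨x, hx⟩ := P.exists_S ht
      obtain ⟨y, hy⟩ := Q.exists_S ht
      obtain ⟨m, h₁, h₂, -⟩ := CMet1.exists_pairing (prodIsProd X Y)
      have e₁ : x = fun n => (prod.fst : X ⨯ Y ⟶ X).1 (m.1 (x n, y n)) :=
        funext fun n => (h₁ (x n, y n)).symm
      have e₂ : y = fun n => (prod.snd : X ⨯ Y ⟶ Y).1 (m.1 (x n, y n)) :=
        funext fun n => (h₂ (x n, y n)).symm
      exact ⟨fun n => m.1 (x n, y n), e₁ ▸ hx, e₂ ▸ hy⟩)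

theorem prodLift_S {T : PERU.{u}} (P : FunRel T (GFun.obj X)) (Q : FunRel T (GFun.obj Y))
    {t : ℕ → T.carrier} {p : ℕ → (X ⨯ Y : CMet1.{u})} : (prodLift P Q).S t p ↔
      P.S t (fun n => (prod.fst : X ⨯ Y ⟶ X).1 (p n)) ∧
      Q.S t (fun n => (prod.snd : X ⨯ Y ⟶ Y).1 (p n)) := null_sup _ _

variable (X Y)

/-- The functor `G` sends products to products. -/
noncomputable def isLimitGProd : IsLimit (BinaryFan.mk (G.map (prod.fst : X ⨯ Y ⟶ X))
    (G.map (prod.snd : X ⨯ Y ⟶ Y))) :=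
  BinaryFan.IsLimit.mk _
    (fun f g => (prodLift (exists_hom f).choose (exists_hom g).choose).hom)
    (fun f g => homS_ext fun t x h => by
      obtain ⟨p, hp, hx⟩ := homS_comp.1 h
      exact ((prodLift_S _ _).1 ((homS_hom _).1 hp)).1.congr hp.left ((homS_map _).1 hx))
    (fun f g => homS_ext fun t x h => by
      obtain ⟨p, hp, hx⟩ := homS_comp.1 h
      exact ((prodLift_S _ _).1 ((homS_hom _).1 hp)).2.congr hp.left ((homS_map _).1 hx))
    (fun f g m h₁ h₂ => homS_ext fun t p hp => by
      subst h₁ h₂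
      exact (homS_hom _).2 ((prodLift_S _ _).2
        ⟨homS_comp.2 ⟨p, hp, (homS_map _).2 (S_refl X _)⟩,
          homS_comp.2 ⟨p, hp, (homS_map _).2 (S_refl Y _)⟩⟩))

end prod

instance : PreservesFiniteProducts G.{u} := by
  have : PreservesLimit (Functor.empty.{0} CMet1.{u}) G :=
    preservesLimit_of_preserves_limit_cone CMet1.isTerminalOne
      ((isLimitMapConeEmptyConeEquiv _ _).symm isTerminalGOne)
  have := preservesLimitsOfShape_pempty_of_preservesTerminal G.{u}
  have : PreservesLimitsOfShape (Discrete WalkingPair) G.{u} := ⟨fun {K} => by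
    have (X Y : CMet1.{u}) : PreservesLimit (pair X Y) G :=
      preservesLimit_of_preserves_limit_cone (prodIsProd X Y)
        ((isLimitMapConeBinaryFanEquiv G _ _).symm (isLimitGProd X Y))
    exact preservesLimit_of_iso_diagram _ (diagramIsoPair K).symm⟩
  exact .of_preserves_binary_and_terminal G

/-! ### The embedding on predicates -/

theorem embPred_le_iff {X : CMet1.{u}} {φ ψ : CMT.pred X} :
    embPred X φ ≤ embPred X ψ ↔ φ ≤ ψ :=
  StrictRel.toSubobject_le_iff

/-- Every strict relation on `G X` is isomorphic to a Lipschitz one. -/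
theorem exists_strictRel_pIso {X : CMet1.{u}} (φ : StrictRel (GFun.obj X)) :
    ∃ ψ : CMT.pred X, PIso (strictRel X ψ) φ := by
  -- Every term is 1-Lipschitz in `x`, hence so is the infimum, with no continuity of `φ` needed. It
  -- is small exactly near points where `φ` is small, and there relationality makes `φ` small too.
  refine ⟨⟨fun x => ⨅ y, φ.pred y ⊔ X.distI x y, uniformContinuous_unitInterval_iff.2
    fun ε hε => ⟨ε, hε, fun a b hab => abs_iInf_sub_iInf_le hε.le fun y => ?_⟩⟩,
    StrictRel.le_iff.2 fun a h => ?_, StrictRel.le_iff.2 fun a h => ?_⟩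
  · refine (abs_max_sub_max_le_max _ _ _ _).trans (max_le (by simpa using hε.le) ?_)
    exact (abs_dist_sub_le a b y).trans hab.le
  · obtain ⟨y, hy⟩ := (null_iInf _).1 h
    obtain ⟨h₁, h₂⟩ := (null_sup _ _).1 hy
    exact φ.null_congr h₁ (S.symm (A := GFun.obj X) h₂)
  · exact (null_iInf _).2 ⟨a, (null_sup _ _).2 ⟨h, S_refl X a⟩⟩

/-- Surjectivity combines two facts: subobjects come from strict relations, and on `G X` these can
be made uniformly continuous. All preservation statements for `η` follow from this equivalence and
preservation of products. -/
theorem isEquiv_embPred :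
    IndexedPreorder.IsEquiv CMT.{u} ((subobjectDoctrine PERU.{u}).baseChange G) embPred where
  equiv X := ⟨fun _ _ => embPred_le_iff, fun s => by
    obtain ⟨φ, rfl⟩ := StrictRel.toSubobject_surjective s
    obtain ⟨ψ, h⟩ := exists_strictRel_pIso φ
    exact ⟨ψ, StrictRel.toSubobject_le_iff.2 h.1, StrictRel.toSubobject_le_iff.2 h.2⟩⟩
  natural {X Y} f φ := by
    have h : PIso (strictRel X (CMT.map f φ)) ((strictRel Y φ).pullback (GFun.map f)) := by
      refine ⟨StrictRel.le_iff.2 fun a h => ?_, StrictRel.le_iff.2 fun a h => ?_⟩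
      · exact (StrictRel.null_pullback _ _ _).2 ⟨fun n => f.1 (a n), S_refl Y _, h⟩
      · obtain ⟨b, hb, h⟩ := (StrictRel.null_pullback _ _ _).1 h
        exact (strictRel Y φ).null_congr h (S.symm ((map_S f).1 hb))
    have e := StrictRel.pullback_toSubobject (GFun.map f) (strictRel Y φ)
    exact ⟨(StrictRel.toSubobject_le_iff.2 h.1).trans e.ge,
      e.le.trans (StrictRel.toSubobject_le_iff.2 h.2)⟩

/-- Transport goes from CMT to the subobjects, so the right adjoints along `G π` need no separate
construction in PER(U). -/
theorem isUniversallyCoherent_baseChange :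
    ((subobjectDoctrine PERU.{u}).baseChange G).IsUniversallyCoherent := by
  obtain ⟨_, -, h⟩ := isEquiv_embPred.{u}.exists_inverse
  exact h.isUniversallyCoherent CMT.isUniversallyCoherent

end ContLogic

theorem mainTheorem3 :
    CMT.{u}.IsUniversallyCoherent ∧
    (subobjectDoctrine PERU.{u}).IsCoherent ∧
    ((subobjectDoctrine PERU.{u}).baseChange G).IsUniversallyCoherent ∧
    IsUniversallyCoherentMorphism CMT.{u} (subobjectDoctrine PERU.{u}) G embPred ∧
    IsEmbedding CMT.{u} (subobjectDoctrine PERU.{u}) G embPred ∧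
    (∀ (A : PERU.{u}) (φ ψ : StrictRel A), φ.toSubobject ≤ ψ.toSubobject ↔ φ ≤ ψ) ∧
    (∀ (A : PERU.{u}) (s : Subobject A), ∃ φ : StrictRel A, φ.toSubobject = s) ∧
    (∀ (A B : PERU.{u}) (F : FunRel A B) (φ : StrictRel B),
      (Subobject.pullback F.hom).obj φ.toSubobject = (φ.pullback F).toSubobject) :=
  ⟨CMT.isUniversallyCoherent, isCoherent_subobjectDoctrine, isUniversallyCoherent_baseChange,
    isEquiv_embPred.isUniversallyCoherentMorphism,
    ⟨full_G, faithful_G, fun _ _ _ => embPred_le_iff⟩,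
    fun _ _ _ => StrictRel.toSubobject_le_iff, fun _ => StrictRel.toSubobject_surjective,
    fun _ _ => StrictRel.pullback_toSubobject⟩
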